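/- All matrices are real, $\|\cdot\|$ is the 2-norm, and $\kappa(X)=\|X\|\,\|X^{-1}\|$ for nonsingular $X$. Let $A\in\mathbb{R}^{n\times n}$, $A\neq 0$. *Hybrid incomplete factorization (HIF).* Put $T_0=A$, $o_0=0$. Level $k=1,\dots,m$ ($m\ge 0$) takes $T_{k-1}=\mathrm{diag}(D_{k-1},S_{k-1})$, where $D_{k-1}$ is diagonal of order $o_{k-1}$ and $S_{k-1}$ is the current Schur complement. It chooses permutation matrices $P_k,Q_k$ and positive diagonal scalings $W_k,V_k$, all acting as the identity on the first $o_{k-1}$ coordinates, and runs a Crout incomplete LU factorization on $\hat A=P_k^TW_kT_{k-1}V_kQ_k$ with nonzero pivots at the positions $o_{k-1}<i\le o_k$, where $o_{k-1}<o_k\le n$. It produces unit triangular $L_k$ and $U_k$ that equal the identity outside the columns (respectively rows) of these positions, and $T_k=\mathrm{diag}(D_k,S_k)$. Here $D_k$ collects all pivots so far and $S_k$ is the Schur complement $C-L_ED_BU_F$ formed with the stored factors. *The droppings are at most $\delta$* if every stored entry of $L_k,U_k$ differs by at most $\delta$ from the value that the algorithm computes for it from the previously stored ones (for example, a computed entry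 of modulus at most $\delta$ is replaced by $0$). With $D=D_m$ of order $d$, $L=W_1^{-1}P_1L_1\cdots W_m^{-1}P_mL_m$ and $U=U_mQ_m^TV_m^{-1}\cdots U_1Q_1^TV_1^{-1}$, the matrix $L\,\mathrm{diag}(D,S_m)\,U$ is the multilevel ILU. The final Schur complement is factorized by QR with column pivoting, $S_mP=QR$, and $R$ is truncated to its leading $s\times s$ block $R_1=R_{1:s,1:s}$. The HIF operator is $$G=U^{-1}\begin{bmatrix}D^{-1}&\\&P\begin{bmatrix}R_1^{-1}&0\\0&0\end{bmatrix}Q^T\end{bmatrix}L^{-1}.$$ Fix a conditioning bound $K$ and a truncation threshold $\tau$. It is required that $L_k,U_k,W_k,V_k$ (for all $k$), $D$ and $\mathrm{diag}(D,R_1)$ are nonsingular with condition number at most $K$, and that column $s+1$ of $R$ is truncated only if $\mathrm{diag}(D,R_{1:s+1,1:s+1})$ is singular or has condition number greater than $\tau$. Say that $\tau$ *resolves the rank* if, for every multilevel ILU of $A$ without dropping ($\delta=0$) with $\kappa(L_k),\kappa(U_k),\kappa(W_k),\kappa(V_k),\kappa(D)\le K$ and every pivoted QR factorization of its $S_m$,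 one has $\kappa(\mathrm{diag}(D,R_{1:\rho,1:\rho}))<\tau$ with $\rho=\mathrm{rank}(S_m)$. *$\epsilon$-accuracy.* With $r=\mathrm{rank}(A)$, $G$ is an $\epsilon$-accurate approximate generalized inverse (AGI) of $A$ if there are a nonsingular $X$ and a matrix $A^g$ with $AA^gA=A$ and $AA^g=X\,\mathrm{diag}(I_r,0)\,X^{-1}$ such that $\|X^{-1}AGX-\mathrm{diag}(I_r,0)\|=\epsilon<1$. *GMRES.* GMRES with right preconditioning operator $G$ has, as $k$th iterate, $x_k=x_0+Gy_k$, where $y_k$ minimizes $\|b-A(x_0+Gy)\|$ over the Krylov subspace $\mathcal K_k=\mathrm{span}\{r_0,AGr_0,\dots,(AG)^{k-1}r_0\}$, $r_0=b-Ax_0$. It has not broken down at step $k$ if $r_0,\dots,(AG)^{k-1}r_0$ are linearly independent and so are their images under $AG$. **Statement.** For every $K$, all sufficiently large $\tau$ resolve the rank. For every $\tau$ that resolves the rank and every $\epsilon>0$ there is $\delta_0>0$, depending only on $A,K,\tau,\epsilon$, such that every HIF operator $G$ of $A$ with droppings at most $\delta_0$, conditioning bound $K$ and truncation threshold $\tau$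 is an $\epsilon'$-accurate AGI of $A$ for some $\epsilon'\le\epsilon$. Moreover, for all $b\in\mathcal R(A)$ and all $x_0\in\mathbb{R}^n$, GMRES (in exact arithmetic) with right preconditioning operator $G$ does not break down before finding a least-squares solution of $Ax\approx b$: for some $k$, it has not broken down at any step $j\le k$, and its (unique) $k$th iterate minimizes $\|b-Ax\|$. -/

import Mathlib

open scoped Matrix Matrix.Norms.L2Operator

/-! ### Matrices: splitting of the index set, condition numbers -/

/-- The splitting of `n` indices into the first `d` and the remaining `n - d`. -/
def splitEquiv {d n : ℕ} (h : d ≤ n) : Fin d ⊕ Fin (n - d) ≃ Fin n :=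
  finSumFinEquiv.trans (finCongr (Nat.add_sub_of_le h))

/-- The `n × n` matrix with diagonal blocks `X` (of order `d`) and `Y`, and zeros elsewhere. -/
def blockDiag {d n : ℕ} (h : d ≤ n) (X : Matrix (Fin d) (Fin d) ℝ)
    (Y : Matrix (Fin (n - d)) (Fin (n - d)) ℝ) : Matrix (Fin n) (Fin n) ℝ :=
  Matrix.reindex (splitEquiv h) (splitEquiv h) (Matrix.fromBlocks X 0 0 Y)

/-- The leading principal `k × k` block. -/
def leadingBlock {k s : ℕ} (h : k ≤ s) (R : Matrix (Fin s) (Fin s) ℝ) :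
    Matrix (Fin k) (Fin k) ℝ :=
  R.submatrix (Fin.castLE h) (Fin.castLE h)

/-- `X` is nonsingular and its 2-norm condition number is at most `K`
(the matrix norm is the spectral norm). -/
def CondLE {ι : Type*} [Fintype ι] [DecidableEq ι] (X : Matrix ι ι ℝ) (K : ℝ) : Prop :=
  IsUnit X.det ∧ ‖X‖ * ‖X⁻¹‖ ≤ K

/-! ### Multilevel incomplete LU factorization with dropping -/

/-- The factors computed at one level, embedded into `n × n` matrices: row and column
permutations, row and column scaling factors, unit lower and unit upper triangular factors. -/
structure ILULevel (n : ℕ) where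
  p : Equiv.Perm (Fin n)
  q : Equiv.Perm (Fin n)
  w : Fin n → ℝ
  v : Fin n → ℝ
  L : Matrix (Fin n) (Fin n) ℝ
  U : Matrix (Fin n) (Fin n) ℝ

namespace ILULevel

variable {n : ℕ}

/-- The row permutation matrix. -/
def P (l : ILULevel n) : Matrix (Fin n) (Fin n) ℝ := l.p.permMatrix ℝ

/-- The column permutation matrix. -/
def Q (l : ILULevel n) : Matrix (Fin n) (Fin n) ℝ := l.q.permMatrix ℝ

/-- The row scaling matrix. -/
def W (l : ILULevel n) : Matrix (Fin n) (Fin n) ℝ := Matrix.diagonal l.w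

/-- The column scaling matrix. -/
def V (l : ILULevel n) : Matrix (Fin n) (Fin n) ℝ := Matrix.diagonal l.v

/-- The scaled and permuted matrix `Pᵀ W T V Q` on which a level works. -/
def prep (l : ILULevel n) (T : Matrix (Fin n) (Fin n) ℝ) : Matrix (Fin n) (Fin n) ℝ :=
  l.Pᵀ * l.W * T * l.V * l.Q

/-- The entry `(i, j)` of `Pᵀ W T V Q` after the updates by the pivots `o ≤ t < c`
of the level; the pivots are the diagonal entries of `T'`. -/
def update (l : ILULevel n) (T T' : Matrix (Fin n) (Fin n) ℝ) (o c : ℕ) (i j : Fin n) : ℝ :=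
  l.prep T i j - ∑ t : Fin n with o ≤ t.val ∧ t.val < c, l.L i t * T' t t * l.U t j

end ILULevel

/-- One level of the incomplete (Crout) factorization. On entry, `T` is block diagonal: its
first `o` rows and columns carry the pivots of the previous levels, and its trailing block is the
matrix to be factorized. The level eliminates the pivots `o ≤ k < o'` (after permutation and
scaling of the trailing block) and returns `T'`, whose first `o'` rows and columns carry all the
pivots so far and whose trailing block is the Schur complement `C - L_E D_B U_F`.
Each stored entry of the triangular factors may differ from the value computed for it by at
most `δ`; in particular, a computed entry of magnitude at most `δ` may be dropped,
i.e. replaced by `0`. With `δ = 0` the factorization is complete. -/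
structure ILUStep {n : ℕ} (δ : ℝ) (o : ℕ) (T : Matrix (Fin n) (Fin n) ℝ) (l : ILULevel n)
    (o' : ℕ) (T' : Matrix (Fin n) (Fin n) ℝ) : Prop where
  lt : o < o'
  le : o' ≤ n
  p_fix : ∀ i : Fin n, i.val < o → l.p i = i
  q_fix : ∀ i : Fin n, i.val < o → l.q i = i
  w_pos : ∀ i, 0 < l.w i
  v_pos : ∀ i, 0 < l.v i
  w_one : ∀ i : Fin n, i.val < o → l.w i = 1
  v_one : ∀ i : Fin n, i.val < o → l.v i = 1
  -- the factors `L`, `U` are unit triangular, and trivial outside the columns (rows) of the level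
  L_diag : ∀ i, l.L i i = 1
  U_diag : ∀ i, l.U i i = 1
  L_upper : ∀ i j, i < j → l.L i j = 0
  U_lower : ∀ i j, j < i → l.U i j = 0
  L_outside : ∀ i k : Fin n, i ≠ k → (k.val < o ∨ o' ≤ k.val) → l.L i k = 0
  U_outside : ∀ k j : Fin n, k ≠ j → (k.val < o ∨ o' ≤ k.val) → l.U k j = 0
  -- the new block diagonal matrix
  off_diag : ∀ i j : Fin n, i ≠ j → (i.val < o' ∨ j.val < o') → T' i j = 0
  old_pivot : ∀ i : Fin n, i.val < o → T' i i = T i i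
  pivot : ∀ k : Fin n, o ≤ k.val → k.val < o' → T' k k = l.update T T' o k.val k k
  pivot_ne : ∀ k : Fin n, o ≤ k.val → k.val < o' → T' k k ≠ 0
  schur : ∀ i j : Fin n, o' ≤ i.val → o' ≤ j.val → T' i j = l.update T T' o o' i j
  -- the computed columns of `L` and rows of `U`, up to dropping
  L_drop : ∀ i k : Fin n, o ≤ k.val → k.val < o' → k < i →
    |l.L i k - l.update T T' o k.val i k / T' k k| ≤ δ
  U_drop : ∀ k j : Fin n, o ≤ k.val → k.val < o' → k < j →
    |l.U k j - l.update T T' o k.val k j / T' k k| ≤ δ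

/-- A chain of levels that leads from `T` (with `o` pivots already eliminated) to `T'`
(with `d` pivots eliminated). -/
inductive ILUChain {n : ℕ} (δ : ℝ) : ℕ → Matrix (Fin n) (Fin n) ℝ → List (ILULevel n) →
    ℕ → Matrix (Fin n) (Fin n) ℝ → Prop
  | nil (o : ℕ) (T : Matrix (Fin n) (Fin n) ℝ) : ILUChain δ o T [] o T
  | cons {o o' d : ℕ} {T T' T'' : Matrix (Fin n) (Fin n) ℝ} {l : ILULevel n}
      {ls : List (ILULevel n)} (step : ILUStep δ o T l o' T')
      (rest : ILUChain δ o' T' ls d T'') : ILUChain δ o T (l :: ls) d T''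

/-- The product `W₁⁻¹ P₁ L₁ ⋯ W_m⁻¹ P_m L_m`. -/
noncomputable def leftProd {n : ℕ} : List (ILULevel n) → Matrix (Fin n) (Fin n) ℝ
  | [] => 1
  | l :: ls => l.W⁻¹ * l.P * l.L * leftProd ls

/-- The product `U_m Q_mᵀ V_m⁻¹ ⋯ U₁ Q₁ᵀ V₁⁻¹`. -/
noncomputable def rightProd {n : ℕ} : List (ILULevel n) → Matrix (Fin n) (Fin n) ℝ
  | [] => 1
  | l :: ls => rightProd ls * (l.U * l.Qᵀ * l.V⁻¹)

/-- The output of a multilevel incomplete LU factorization: the levels, the number `d` of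
eliminated pivots, and the block diagonal matrix `core` with blocks `D` and `S_m`. -/
structure MLILU (n : ℕ) where
  levels : List (ILULevel n)
  d : ℕ
  d_le : d ≤ n
  core : Matrix (Fin n) (Fin n) ℝ

namespace MLILU

variable {n : ℕ}

/-- `F` is a multilevel ILU factorization of `A` in which no dropping exceeds `δ`. -/
def IsFactorization (F : MLILU n) (A : Matrix (Fin n) (Fin n) ℝ) (δ : ℝ) : Prop :=
  ILUChain δ 0 A F.levels F.d F.core

/-- All the pivots, from all levels. -/
def pivots (F : MLILU n) : Fin F.d → ℝ :=
  fun i => F.core (Fin.castLE F.d_le i) (Fin.castLE F.d_le i)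

/-- The final Schur complement `S_m`. -/
def schur (F : MLILU n) : Matrix (Fin (n - F.d)) (Fin (n - F.d)) ℝ :=
  F.core.submatrix (fun i => splitEquiv F.d_le (Sum.inr i)) (fun i => splitEquiv F.d_le (Sum.inr i))

/-- The triangular, scaling and diagonal factors have condition numbers at most `K`. -/
def WellConditioned (F : MLILU n) (K : ℝ) : Prop :=
  (∀ l ∈ F.levels, CondLE l.L K ∧ CondLE l.U K ∧ CondLE l.W K ∧ CondLE l.V K) ∧
    CondLE (Matrix.diagonal F.pivots) K

/-- The block diagonal matrix with blocks `D` and `R_{1:k,1:k}`. -/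
def middle (F : MLILU n) {k : ℕ} (hk : k ≤ n - F.d)
    (R : Matrix (Fin (n - F.d)) (Fin (n - F.d)) ℝ) :
    Matrix (Fin F.d ⊕ Fin k) (Fin F.d ⊕ Fin k) ℝ :=
  Matrix.fromBlocks (Matrix.diagonal F.pivots) 0 0 (leadingBlock hk R)

end MLILU

/-! ### QR factorization with column pivoting, truncation, and the hybrid operator -/

/-- `S P = Q R` is a QR factorization with column pivoting: `P` is the permutation matrix of `π`,
`Q` is orthogonal, `R` is upper triangular with nonnegative diagonal, and at each step the pivot
column has maximal norm among the remaining (projected) columns. In particular, the diagonal of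
`R` is nonincreasing. -/
structure IsQRCP {s : ℕ} (S : Matrix (Fin s) (Fin s) ℝ) (π : Equiv.Perm (Fin s))
    (Q R : Matrix (Fin s) (Fin s) ℝ) : Prop where
  eq : S * π.permMatrix ℝ = Q * R
  orth : Qᵀ * Q = 1
  upper : ∀ i j, j < i → R i j = 0
  diag_nonneg : ∀ i, 0 ≤ R i i
  pivoting : ∀ i j, i ≤ j → ∑ t ∈ Finset.Ici i, R t j ^ 2 ≤ R i i ^ 2

/-- The inverse of the leading `k × k` block of `R`, padded with zeros. -/
noncomputable def paddedInv {k s : ℕ} (hk : k ≤ s) (R : Matrix (Fin s) (Fin s) ℝ) :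
    Matrix (Fin s) (Fin s) ℝ :=
  blockDiag hk (leadingBlock hk R)⁻¹ 0

/-- The hybrid incomplete factorization operator
`G = U⁻¹ diag(D⁻¹, P diag(R₁⁻¹, 0) Qᵀ) L⁻¹` with `R₁ = R_{1:k,1:k}`. -/
noncomputable def hifOperator {n : ℕ} (F : MLILU n) (π : Equiv.Perm (Fin (n - F.d)))
    (Q R : Matrix (Fin (n - F.d)) (Fin (n - F.d)) ℝ) {k : ℕ} (hk : k ≤ n - F.d) :
    Matrix (Fin n) (Fin n) ℝ :=
  (rightProd F.levels)⁻¹ *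
    blockDiag F.d_le (Matrix.diagonal F.pivots)⁻¹ (π.permMatrix ℝ * paddedInv hk R * Qᵀ) *
    (leftProd F.levels)⁻¹

/-- `G` is a hybrid incomplete factorization operator of `A`, computed with droppings of size at
most `δ`, factors of condition number at most `K`, and truncation threshold `τ`: the
multilevel ILU and a QRCP of its final Schur complement are computed, and `R` is truncated to its
leading `k × k` block, where the retained middle factor `diag(D, R_{1:k,1:k})` has condition number
at most `K`, and where column `k + 1` is truncated only if retaining it would push this condition
number above `τ`. -/
def IsHIF {n : ℕ} (A : Matrix (Fin n) (Fin n) ℝ) (δ K τ : ℝ) (G : Matrix (Fin n) (Fin n) ℝ) :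
    Prop :=
  ∃ (F : MLILU n) (π : Equiv.Perm (Fin (n - F.d)))
    (Q R : Matrix (Fin (n - F.d)) (Fin (n - F.d)) ℝ) (k : ℕ) (hk : k ≤ n - F.d),
    F.IsFactorization A δ ∧ F.WellConditioned K ∧ IsQRCP F.schur π Q R ∧
    CondLE (F.middle hk R) K ∧
    (∀ hk' : k + 1 ≤ n - F.d, ¬ CondLE (F.middle hk' R) τ) ∧
    G = hifOperator F π Q R hk

/-- The truncation threshold `τ` does not cut into the exact rank: for each factorization of `A`
without dropping whose factors have condition numbers at most `K`, and each QRCP of its final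
Schur complement, the middle factor `diag(D, R₁)`, with `R₁` of order the rank of the Schur
complement, has condition number less than `τ`. -/
def ResolvesRank {n : ℕ} (A : Matrix (Fin n) (Fin n) ℝ) (K τ : ℝ) : Prop :=
  ∀ (F : MLILU n) (π : Equiv.Perm (Fin (n - F.d)))
    (Q R : Matrix (Fin (n - F.d)) (Fin (n - F.d)) ℝ) (k : ℕ) (hk : k ≤ n - F.d),
    F.IsFactorization A 0 → F.WellConditioned K → IsQRCP F.schur π Q R → k = F.schur.rank →
    ‖F.middle hk R‖ * ‖(F.middle hk R)⁻¹‖ < τ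

/-! ### Approximate generalized inverses -/

/-- The matrix `diag(I_r, 0)`. -/
def idBlock (n r : ℕ) : Matrix (Fin n) (Fin n) ℝ :=
  Matrix.diagonal fun i => if i.val < r then 1 else 0

/-- `G` is an `ε`-accurate approximate generalized inverse of `A`. -/
def IsAccurateAGI {n : ℕ} (A G : Matrix (Fin n) (Fin n) ℝ) (ε : ℝ) : Prop :=
  ∃ X : Matrix (Fin n) (Fin n) ℝ, IsUnit X.det ∧
    (∃ Ag : Matrix (Fin n) (Fin n) ℝ, A * Ag * A = A ∧ A * Ag = X * idBlock n A.rank * X⁻¹) ∧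
    ‖X⁻¹ * A * G * X - idBlock n A.rank‖ = ε ∧ ε < 1

/-! ### Right-preconditioned GMRES -/

/-- The Euclidean norm of the residual `b - A x`. -/
noncomputable def residualNorm {n : ℕ} (A : Matrix (Fin n) (Fin n) ℝ) (b x : Fin n → ℝ) : ℝ :=
  ‖WithLp.toLp 2 (b - A.mulVec x)‖

/-- `x` is a least-squares solution of `A x ≈ b`. -/
def IsLSSolution {n : ℕ} (A : Matrix (Fin n) (Fin n) ℝ) (b x : Fin n → ℝ) : Prop :=
  ∀ z, residualNorm A b x ≤ residualNorm A b z

/-- The columns `v, B v, …, B^{k-1} v` of the `k`th Krylov matrix. -/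
def krylovVec {n : ℕ} (B : Matrix (Fin n) (Fin n) ℝ) (v : Fin n → ℝ) (k : ℕ) :
    Fin k → Fin n → ℝ :=
  fun i => (B ^ i.val).mulVec v

/-- The `k`th Krylov subspace. -/
def krylov {n : ℕ} (B : Matrix (Fin n) (Fin n) ℝ) (v : Fin n → ℝ) (k : ℕ) :
    Submodule ℝ (Fin n → ℝ) :=
  Submodule.span ℝ (Set.range (krylovVec B v k))

/-- `x` is a `k`th iterate of GMRES with right preconditioning operator `G` and initial guess
`x₀`: `x = x₀ + G y`, where `y` minimizes the residual over the `k`th Krylov subspace of `A G` and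
the initial residual. -/
def IsGMRESIterate {n : ℕ} (A G : Matrix (Fin n) (Fin n) ℝ) (b x₀ : Fin n → ℝ) (k : ℕ)
    (x : Fin n → ℝ) : Prop :=
  ∃ y ∈ krylov (A * G) (b - A.mulVec x₀) k, x = x₀ + G.mulVec y ∧
    ∀ z ∈ krylov (A * G) (b - A.mulVec x₀) k,
      residualNorm A b x ≤ residualNorm A b (x₀ + G.mulVec z)

/-- GMRES with right preconditioning operator `G` has not broken down at step `k`: the Krylov
matrix has linearly independent columns, and the projected least-squares problem that determines
the iterate has full rank. -/
def NoBreakdownAt {n : ℕ} (A G : Matrix (Fin n) (Fin n) ℝ) (b x₀ : Fin n → ℝ) (k : ℕ) : Prop :=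
  LinearIndependent ℝ (krylovVec (A * G) (b - A.mulVec x₀) k) ∧
    LinearIndependent ℝ (fun i => (A * G).mulVec (krylovVec (A * G) (b - A.mulVec x₀) k i))

/-- GMRES with right preconditioning operator `G` does not break down before it finds a
least-squares solution: at some step `k`, no breakdown has occurred up to that step, and the
iterate is a least-squares solution. -/
def GMRESFindsLS {n : ℕ} (A G : Matrix (Fin n) (Fin n) ℝ) (b x₀ : Fin n → ℝ) : Prop :=
  ∃ k : ℕ, (∀ j ≤ k, NoBreakdownAt A G b x₀ j) ∧
    ∃ x, IsGMRESIterate A G b x₀ k x ∧ IsLSSolution A b x ∧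
      ∀ x', IsGMRESIterate A G b x₀ k x' → x' = x

/-!
The first claim and the accuracy of the hybrid operators follow from a compactness argument.

Multiplying the row and column scalings of the first level by positive numbers multiplies all
pivots and Schur complements by a constant, and changes neither the hybrid operator nor the
condition numbers (`ILUChain.exists_normalized`, `MLILU.exists_isNormalizedQR`). So the scalings
may be assumed to have an entry equal to `1`. The bound `K` then keeps the entries of all
triangular and scaling factors bounded. The first pivot is a nonzero entry of `A` up to scaling,
and the other pivots are comparable to it, so all pivots are bounded away from `0` and infinity
(`MLILU.exists_pivot_bounds`). Hence a sequence of factorizations with droppings tending to `0`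
converges along an ultrafilter to a factorization without dropping, together with the pivoted QR
factorizations of the Schur complements (`ILUChain.exists_limit`, `IsQRCP.exists_limit`).

A factorization without dropping is exact, `A = L diag(D, S) U` (`ILUChain.eq_mul`), and a pivoted
QR factorization reveals the rank of `S` (`IsQRCP.of_rank`). Truncated at this rank, the hybrid
operator is a generalized inverse `Ag` of `A` with `A Ag = X diag(I_r, 0) X⁻¹` for
`X = L diag(I, Q)`, and `rank A = d + rank S` (`exact_hifOperator`). In particular,
the rank of `S` is the same for all exact factorizations with `d` pivots, so the condition
numbers at the exact rank cannot be unbounded (`exists_resolvesRank`). If the threshold resolves the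
rank, then a sequence of hybrid factorizations with droppings tending to `0` is eventually truncated
at the rank of the limiting Schur complement (`eq_rank_of_limit`), and the hybrid operators
converge to `Ag`. Therefore
`X⁻¹ A G X` tends to `diag(I_r, 0)` (`exists_accurateAGI`).

An accurate approximate generalized inverse makes `A G` injective on the range of `A`
(`IsAccurateAGI.eq_zero_of_mulVec_eq_zero`). This range contains the Krylov subspaces. The first
of them that is invariant under `A G` is mapped onto itself, so it contains a solution of
`A G y = b - A x₀` (`gmresFindsLS_of_injOn`).
-/

open Filter Topology

/-! ### Limits along ultrafilters -/

lemma Ultrafilter.exists_eventually_eq {ι β : Type*} [Finite β] (u : Ultrafilter ι) (f : ι → β) :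
    ∃ b, ∀ᶠ i in (u : Filter ι), f i = b := by
  obtain ⟨b, -, hb⟩ := (Ultrafilter.finite_biUnion_mem_iff (f := u.map f) (is := Set.univ)
    (s := fun b => {b}) Set.finite_univ).1 (by rw [Set.biUnion_of_singleton]; exact univ_mem)
  exact ⟨b, hb⟩

lemma Ultrafilter.exists_tendsto_of_abs_le {ι : Type*} (u : Ultrafilter ι) {f : ι → ℝ} {C : ℝ}
    (h : ∀ᶠ i in (u : Filter ι), |f i| ≤ C) : ∃ x, Tendsto f u (𝓝 x) := by
  obtain ⟨x, -, hx⟩ := (isCompact_Icc (a := -C) (b := C)).ultrafilter_le_nhds (u.map f)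
    (le_principal_iff.2 (h.mono fun i hi => abs_le.1 hi))
  exact ⟨x, hx⟩

lemma tendsto_matrix_iff {ι m n : Type*} {F : Filter ι} {M : ι → Matrix m n ℝ} {M₀ : Matrix m n ℝ} :
    Tendsto M F (𝓝 M₀) ↔ ∀ a b, Tendsto (fun i => M i a b) F (𝓝 (M₀ a b)) := by
  refine (tendsto_pi_nhds (f := M) (g := M₀)).trans (forall_congr' fun a => tendsto_pi_nhds)

lemma exists_tendsto_matrix {ι m n : Type*} {F : Filter ι} {M : ι → Matrix m n ℝ}
    (h : ∀ a b, ∃ x, Tendsto (fun i => M i a b) F (𝓝 x)) : ∃ M₀, Tendsto M F (𝓝 M₀) := by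
  choose M₀ hM using h
  exact ⟨M₀, tendsto_matrix_iff.2 hM⟩

/-! ### Spectral norms, inverses and condition numbers -/

section Norms

variable {ι κ : Type*} [Fintype ι] [DecidableEq ι] [Fintype κ] [DecidableEq κ]

lemma norm_one_submatrix_le {f : κ → ι} (hf : Function.Injective f) :
    ‖(1 : Matrix ι ι ℝ).submatrix id f‖ ≤ 1 := by
  have h := Matrix.l2_opNorm_conjTranspose_mul_self ((1 : Matrix ι ι ℝ).submatrix id f)
  have h1 : ((1 : Matrix ι ι ℝ).submatrix id f)ᴴ * (1 : Matrix ι ι ℝ).submatrix id f = 1 := by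
    ext a b
    simp [Matrix.mul_apply, Matrix.one_apply, hf.eq_iff]
  rw [h1] at h
  have h2 : ‖(1 : Matrix κ κ ℝ)‖ ≤ 1 := by
    rw [← Matrix.diagonal_one, Matrix.l2_opNorm_diagonal]
    exact (pi_norm_le_iff_of_nonneg zero_le_one).2 fun _ => by simp
  nlinarith [norm_nonneg ((1 : Matrix ι ι ℝ).submatrix id f)]

lemma norm_submatrix_le (M : Matrix ι ι ℝ) {f : κ → ι} (hf : Function.Injective f) :
    ‖M.submatrix f f‖ ≤ ‖M‖ := by
  set E := (1 : Matrix ι ι ℝ).submatrix id f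
  have hE : ‖E‖ ≤ 1 := norm_one_submatrix_le hf
  have h : M.submatrix f f = Eᴴ * M * E := by
    ext a b
    simp [E, Matrix.mul_apply, Matrix.one_apply]
  calc ‖M.submatrix f f‖ ≤ ‖Eᴴ‖ * ‖M‖ * ‖E‖ := by
        rw [h]
        exact (Matrix.l2_opNorm_mul _ _).trans
          (mul_le_mul_of_nonneg_right (Matrix.l2_opNorm_mul _ _) (norm_nonneg _))
    _ ≤ 1 * ‖M‖ * 1 := by
        rw [Matrix.l2_opNorm_conjTranspose]
        gcongr
    _ = ‖M‖ := by ring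

lemma abs_apply_le_norm (M : Matrix ι ι ℝ) (i j : ι) : |M i j| ≤ ‖M‖ := by
  have h := Matrix.l2_opNorm_mulVec M (EuclideanSpace.single j (1 : ℝ))
  have h2 := PiLp.norm_apply_le (WithLp.toLp 2 (M *ᵥ (EuclideanSpace.single j (1 : ℝ)).ofLp)) i
  have h3 : (M *ᵥ (EuclideanSpace.single j (1 : ℝ)).ofLp) i = M i j := by
    simp [Matrix.mulVec, dotProduct]
  simp only [h3, Real.norm_eq_abs] at h2
  simpa using h2.trans h

/-- Matrix inversion commutes with scaling, also for singular matrices, where both sides are `0`. -/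
lemma inv_smul_of_ne_zero (M : Matrix ι ι ℝ) {c : ℝ} (hc : c ≠ 0) : (c • M)⁻¹ = c⁻¹ • M⁻¹ := by
  by_cases h : IsUnit M.det
  · exact Matrix.inv_smul' M (Units.mk0 c hc) h
  · have h' : ¬ IsUnit (c • M).det := by
      rw [Matrix.det_smul]
      simpa [hc] using h
    rw [Matrix.nonsing_inv_apply_not_isUnit _ h, Matrix.nonsing_inv_apply_not_isUnit _ h',
      smul_zero]

lemma norm_smul_mul_norm_inv (M : Matrix ι ι ℝ) {c : ℝ} (hc : c ≠ 0) :
    ‖c • M‖ * ‖(c • M)⁻¹‖ = ‖M‖ * ‖M⁻¹‖ := by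
  rw [inv_smul_of_ne_zero M hc, norm_smul, norm_smul, norm_inv]
  have : ‖c‖ ≠ 0 := norm_ne_zero_iff.2 hc
  field_simp

lemma condLE_smul_iff (M : Matrix ι ι ℝ) {c K : ℝ} (hc : c ≠ 0) :
    CondLE (c • M) K ↔ CondLE M K := by
  unfold CondLE
  rw [norm_smul_mul_norm_inv M hc, Matrix.det_smul]
  simp [hc]

lemma CondLE.norm_mul_norm_le {M : Matrix ι ι ℝ} {K : ℝ} (h : CondLE M K) {v : EuclideanSpace ℝ ι} :
    ‖M‖ * ‖v‖ ≤ K * ‖WithLp.toLp 2 (M *ᵥ v.ofLp)‖ := by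
  have h1 := Matrix.l2_opNorm_mulVec M⁻¹ (WithLp.toLp 2 (M *ᵥ v.ofLp))
  simp only [Matrix.mulVec_mulVec, Matrix.nonsing_inv_mul _ h.1, Matrix.one_mulVec] at h1
  calc ‖M‖ * ‖v‖ ≤ ‖M‖ * (‖M⁻¹‖ * ‖WithLp.toLp 2 (M *ᵥ v.ofLp)‖) := by
        gcongr
        simpa using h1
    _ = (‖M‖ * ‖M⁻¹‖) * ‖WithLp.toLp 2 (M *ᵥ v.ofLp)‖ := by ring
    _ ≤ _ := by gcongr; exact h.2

lemma tendsto_matrix_inv {α : Type*} {F : Filter α} {M : α → Matrix ι ι ℝ} {M₀ : Matrix ι ι ℝ}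
    (h : Tendsto M F (𝓝 M₀)) (h₀ : IsUnit M₀.det) :
    Tendsto (fun i => (M i)⁻¹) F (𝓝 M₀⁻¹) := by
  refine (continuousAt_matrix_inv M₀ ?_).tendsto.comp h
  rw [Ring.inverse_eq_inv']
  exact continuousAt_inv₀ h₀.ne_zero

lemma tendsto_norm_mul_norm_inv {α : Type*} {F : Filter α} {M : α → Matrix ι ι ℝ}
    {M₀ : Matrix ι ι ℝ} (h : Tendsto M F (𝓝 M₀)) (h₀ : IsUnit M₀.det) :
    Tendsto (fun i => ‖M i‖ * ‖(M i)⁻¹‖) F (𝓝 (‖M₀‖ * ‖M₀⁻¹‖)) :=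
  h.norm.mul (tendsto_matrix_inv h h₀).norm

lemma eventually_isUnit_det {α : Type*} {F : Filter α} {M : α → Matrix ι ι ℝ}
    {M₀ : Matrix ι ι ℝ} (h : Tendsto M F (𝓝 M₀)) (h₀ : IsUnit M₀.det) :
    ∀ᶠ i in F, IsUnit (M i).det := by
  have h1 : Tendsto (fun i => (M i).det) F (𝓝 M₀.det) :=
    ((continuous_id.matrix_det (A := fun M : Matrix ι ι ℝ => M)).tendsto M₀).comp h
  exact (h1.eventually_ne h₀.ne_zero).mono fun i hi => isUnit_iff_ne_zero.2 hi

lemma CondLE.of_tendsto {α : Type*} {F : Filter α} [F.NeBot] {M : α → Matrix ι ι ℝ}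
    {M₀ : Matrix ι ι ℝ} {K : ℝ} (h : Tendsto M F (𝓝 M₀)) (hK : ∀ᶠ i in F, CondLE (M i) K)
    (h₀ : IsUnit M₀.det) : CondLE M₀ K :=
  ⟨h₀, le_of_tendsto (tendsto_norm_mul_norm_inv h h₀) (hK.mono fun _ hi => hi.2)⟩

/-- The matrices with condition number at most `K` are closed among the nonzero matrices:
the bound `‖M‖ ‖v‖ ≤ K ‖M v‖` passes to the limit and makes it injective. -/
lemma CondLE.of_tendsto_of_ne_zero {α : Type*} {F : Filter α} [F.NeBot] {M : α → Matrix ι ι ℝ}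
    {M₀ : Matrix ι ι ℝ} {K : ℝ} (h : Tendsto M F (𝓝 M₀)) (hK : ∀ᶠ i in F, CondLE (M i) K)
    (h₀ : M₀ ≠ 0) : CondLE M₀ K := by
  refine CondLE.of_tendsto h hK ?_
  rw [← Matrix.isUnit_iff_isUnit_det, ← Matrix.mulVec_injective_iff_isUnit]
  refine (injective_iff_map_eq_zero (Matrix.mulVecLin M₀)).2 fun v hv => ?_
  rw [Matrix.mulVecLin_apply] at hv
  have h1 : Tendsto (fun i => ‖WithLp.toLp 2 (M i *ᵥ v)‖) F (𝓝 ‖WithLp.toLp 2 (M₀ *ᵥ v)‖) := by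
    have hc : Continuous fun N : Matrix ι ι ℝ => ‖WithLp.toLp 2 (N *ᵥ v)‖ :=
      ((PiLp.continuous_toLp 2 _).comp (continuous_id.matrix_mulVec continuous_const)).norm
    exact (hc.tendsto M₀).comp h
  have h2 := le_of_tendsto_of_tendsto (h.norm.mul_const ‖WithLp.toLp 2 v‖) (h1.const_mul K)
    (hK.mono fun i hi => hi.norm_mul_norm_le (v := WithLp.toLp 2 v))
  rw [hv] at h2
  have h3 : 0 < ‖M₀‖ := norm_pos_iff.2 h₀
  have h4 : ‖WithLp.toLp 2 v‖ ≤ 0 := by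
    simp only [WithLp.toLp_zero, norm_zero, mul_zero] at h2
    nlinarith
  have h5 := norm_le_zero_iff.1 h4
  simpa using h5

/-- If the columns of `M` in the range of `f` vanish outside of the rows in the range of `f`, then
the compression of `M⁻¹` to these indices inverts that of `M`. -/
lemma submatrix_inv_mul_submatrix {M : Matrix ι ι ℝ} (hM : IsUnit M.det) {f : κ → ι}
    (hf : Function.Injective f) (h : ∀ t j, t ∉ Set.range f → M t (f j) = 0) :
    M⁻¹.submatrix f f * M.submatrix f f = 1 := by
  ext a b
  have h1 : (M⁻¹ * M) (f a) (f b) = (1 : Matrix κ κ ℝ) a b := by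
    rw [Matrix.nonsing_inv_mul _ hM]
    simp [Matrix.one_apply, hf.eq_iff]
  rw [← h1, Matrix.mul_apply, Matrix.mul_apply]
  refine (Finset.sum_image (s := Finset.univ) (g := f) (f := fun t => M⁻¹ (f a) t * M t (f b))
    hf.injOn).symm.trans ?_
  refine Finset.sum_subset (Finset.subset_univ _) fun t _ ht => ?_
  rw [h t b (by simpa using ht), mul_zero]

lemma condLE_submatrix {M : Matrix ι ι ℝ} (hM : IsUnit M.det) {f : κ → ι}
    (hf : Function.Injective f) (h : ∀ t j, t ∉ Set.range f → M t (f j) = 0) :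
    CondLE (M.submatrix f f) (‖M‖ * ‖M⁻¹‖) := by
  have h1 := submatrix_inv_mul_submatrix hM hf h
  refine ⟨Matrix.isUnit_det_of_left_inverse h1, ?_⟩
  rw [Matrix.inv_eq_left_inv h1]
  gcongr
  · exact norm_submatrix_le M hf
  · exact norm_submatrix_le _ hf

/-- If `M` fixes a unit vector, then `‖M⁻¹‖ ≥ 1`, so that a bound for the condition number bounds
the norm. -/
lemma CondLE.norm_le_of_mulVec_eq {M : Matrix ι ι ℝ} {K : ℝ} (h : CondLE M K) {i : ι}
    (hi : M *ᵥ Pi.single i 1 = Pi.single i 1) : ‖M‖ ≤ K := by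
  have h1 := h.norm_mul_norm_le (v := EuclideanSpace.single i 1)
  have h2 : (EuclideanSpace.single i (1 : ℝ)).ofLp = Pi.single i 1 := rfl
  rw [h2, hi] at h1
  have h3 : ‖(WithLp.toLp 2 (Pi.single i 1) : EuclideanSpace ℝ ι)‖ = 1 := by
    change ‖EuclideanSpace.single i (1 : ℝ)‖ = 1
    simp
  rw [h3] at h1
  simpa using h1

lemma CondLE.diagonal_abs_le {d : ι → ℝ} {K : ℝ} (h : CondLE (Matrix.diagonal d) K) (i j : ι) :
    |d i| ≤ K * |d j| := by
  have h1 := h.norm_mul_norm_le (v := EuclideanSpace.single j 1)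
  have h2 : (EuclideanSpace.single j (1 : ℝ)).ofLp = Pi.single j 1 := rfl
  rw [h2, Matrix.diagonal_mulVec_single] at h1
  have h3 : ‖(WithLp.toLp 2 (Pi.single j (d j * 1)) : EuclideanSpace ℝ ι)‖ = |d j| := by
    change ‖EuclideanSpace.single j (d j * 1)‖ = |d j|
    simp
  rw [h3] at h1
  have h4 := abs_apply_le_norm (Matrix.diagonal d) i i
  rw [Matrix.diagonal_apply_eq] at h4
  simp only [PiLp.norm_single, norm_one, mul_one] at h1
  exact h4.trans h1

end Norms

/-! ### Exactness and scaling of the multilevel factorization -/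

section Levels

variable {n : ℕ}

lemma ILULevel.prep_apply (l : ILULevel n) (T : Matrix (Fin n) (Fin n) ℝ) (i j : Fin n) :
    l.prep T i j
      = l.w (l.p.symm i) * T (l.p.symm i) (l.q.symm j) * l.v (l.q.symm j) := by
  unfold ILULevel.prep ILULevel.P ILULevel.Q ILULevel.W ILULevel.V
  rw [Matrix.transpose_permMatrix, PEquiv.mul_toMatrix_toPEquiv, Matrix.submatrix_apply,
    Matrix.mul_diagonal, Matrix.mul_assoc, PEquiv.toMatrix_toPEquiv_mul, Matrix.submatrix_apply,
    Matrix.diagonal_mul]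
  rfl

lemma ILULevel.P_mul_transpose (l : ILULevel n) : l.P * l.Pᵀ = 1 := by
  rw [ILULevel.P, Matrix.transpose_permMatrix, ← Matrix.permMatrix_mul]
  simp

lemma ILULevel.Q_mul_transpose (l : ILULevel n) : l.Q * l.Qᵀ = 1 := by
  rw [ILULevel.Q, Matrix.transpose_permMatrix, ← Matrix.permMatrix_mul]
  simp

variable {δ : ℝ} {o o' : ℕ} {T T' : Matrix (Fin n) (Fin n) ℝ} {l : ILULevel n}

lemma ILUStep.mono {δ' : ℝ} (h : ILUStep δ o T l o' T') (hδ : δ ≤ δ') : ILUStep δ' o T l o' T' :=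
  { h with
    L_drop := fun i k h1 h2 h3 => (h.L_drop i k h1 h2 h3).trans hδ
    U_drop := fun i k h1 h2 h3 => (h.U_drop i k h1 h2 h3).trans hδ }

lemma ILUChain.mono {δ' : ℝ} {ls : List (ILULevel n)} {d : ℕ} (h : ILUChain δ o T ls d T')
    (hδ : δ ≤ δ') : ILUChain δ' o T ls d T' := by
  induction h with
  | nil o T => exact .nil o T
  | cons step _ ih => exact .cons (step.mono hδ) ih

/-- The product `L T' U` at the entry `(i, j)`: since `T'` is block diagonal and `L`, `U` are
trivial outside the level, only the pivots and the Schur complement contribute. -/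
lemma ILUStep.mul_mul_apply (h : ILUStep δ o T l o' T') (i j : Fin n) :
    (l.L * T' * l.U) i j
      = (∑ t : Fin n, if t.val < o' then l.L i t * T' t t * l.U t j else 0)
        + if o' ≤ j.val then T' i j else 0 := by
  have h1 : ∀ t : Fin n, (l.L * T') i t = if t.val < o' then l.L i t * T' t t else T' i t := by
    intro t
    rw [Matrix.mul_apply]
    split_ifs with ht
    · refine Finset.sum_eq_single_of_mem t (Finset.mem_univ _) fun s _ hs => ?_
      rw [h.off_diag s t hs (Or.inr ht), mul_zero]
    · rw [Finset.sum_eq_single_of_mem i (Finset.mem_univ _) fun s _ hs => ?_, h.L_diag, one_mul]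
      by_cases hs' : s.val < o'
      · rw [h.off_diag s t (fun hst => ht (hst ▸ hs')) (Or.inl hs'), mul_zero]
      · rw [h.L_outside i s hs.symm (Or.inr (not_lt.1 hs')), zero_mul]
  have h2 : (if o' ≤ j.val then T' i j else 0)
      = ∑ t : Fin n, if t.val < o' then 0 else T' i t * l.U t j := by
    split_ifs with hj
    · rw [Finset.sum_eq_single_of_mem j (Finset.mem_univ _) fun t _ ht => ?_, if_neg hj.not_gt,
        h.U_diag, mul_one]
      split_ifs with ht'
      · rfl
      · rw [h.U_outside t j ht (Or.inr (not_lt.1 ht')), mul_zero]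
    · refine (Finset.sum_eq_zero fun t _ => ?_).symm
      split_ifs with ht'
      · rfl
      · rw [h.U_outside t j (fun htj => ht' (htj ▸ not_le.1 hj)) (Or.inr (not_lt.1 ht')), mul_zero]
  rw [h2, ← Finset.sum_add_distrib, Matrix.mul_apply]
  refine Finset.sum_congr rfl fun t _ => ?_
  rw [h1]
  split_ifs <;> simp

/-- Without dropping, one level is an exact block LU factorization of the permuted and scaled
matrix. -/
lemma ILUStep.prep_eq (h : ILUStep 0 o T l o' T')
    (hT : ∀ i j : Fin n, i ≠ j → (i.val < o ∨ j.val < o) → T i j = 0) :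
    l.prep T = l.L * T' * l.U := by
  ext i j
  rw [h.mul_mul_apply]
  have hL : ∀ t : Fin n, t.val < o → t ≠ i → l.L i t = 0 := fun t ht hti =>
    h.L_outside i t hti.symm (Or.inl ht)
  have hU : ∀ t : Fin n, t.val < o → t ≠ j → l.U t j = 0 := fun t ht hti =>
    h.U_outside t j hti (Or.inl ht)
  have hoo := h.lt
  -- the sum over all pivots, when the pivot `m = min i j` belongs to the level
  have hsum : ∀ m : Fin n, o ≤ m.val → m.val < o' → m ≤ i → m ≤ j → (m = i ∨ m = j) →
      (∑ t : Fin n, if t.val < o' then l.L i t * T' t t * l.U t j else 0)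
        = (∑ t : Fin n with o ≤ t.val ∧ t.val < m.val, l.L i t * T' t t * l.U t j)
          + l.L i m * T' m m * l.U m j := by
    intro m h1 h2 hmi hmj hm
    rw [Finset.sum_filter, ← Finset.sum_ite_eq_of_mem' Finset.univ m
      (fun t => l.L i t * T' t t * l.U t j) (Finset.mem_univ _), ← Finset.sum_add_distrib]
    refine Finset.sum_congr rfl fun t _ => ?_
    rcases lt_trichotomy t m with htm | htm | htm
    · have htm' : t.val < m.val := htm
      rw [if_pos (by omega), if_neg htm.ne, add_zero]
      split_ifs with hot
      · rfl
      · rw [hL t (by omega) (htm.trans_le hmi).ne, zero_mul, zero_mul]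
    · subst htm
      simp [h2]
    · have htm' : m.val < t.val := htm
      rw [if_neg (by omega : ¬ (o ≤ t.val ∧ t.val < m.val)), if_neg htm.ne', add_zero]
      split_ifs
      · rcases hm with rfl | rfl
        · rw [h.L_upper _ _ htm, zero_mul, zero_mul]
        · rw [h.U_lower _ _ htm, mul_zero]
      · rfl
  by_cases hio : i.val < o ∨ j.val < o
  · -- rows and columns of the earlier pivots
    have hprep : l.prep T i j = if i = j then T' i i else 0 := by
      rw [ILULevel.prep_apply]
      rcases hio with hio | hjo
      · have hp : l.p.symm i = i := by rw [Equiv.symm_apply_eq, h.p_fix i hio]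
        rw [hp, h.w_one i hio, one_mul]
        split_ifs with hij
        · have hq : l.q.symm j = j := by rw [Equiv.symm_apply_eq, h.q_fix j (hij ▸ hio)]
          rw [hq, h.v_one j (hij ▸ hio), mul_one, ← hij, h.old_pivot i hio]
        · rw [hT _ _ (fun hc => hij ?_) (Or.inl hio), zero_mul]
          rw [← h.q_fix i hio, hc, Equiv.apply_symm_apply]
      · have hq : l.q.symm j = j := by rw [Equiv.symm_apply_eq, h.q_fix j hjo]
        rw [hq, h.v_one j hjo, mul_one]
        split_ifs with hij
        · have hp : l.p.symm i = i := by rw [Equiv.symm_apply_eq, h.p_fix i (hij ▸ hjo)]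
          rw [hp, h.w_one i (hij ▸ hjo), one_mul, ← hij, h.old_pivot i (hij ▸ hjo)]
        · rw [hT _ _ (fun hc => hij ?_) (Or.inr hjo), mul_zero]
          rw [← h.p_fix j hjo, ← hc, Equiv.apply_symm_apply]
    have h0 : (if o' ≤ j.val then T' i j else 0) = 0 := by
      split_ifs with hj
      · rcases hio with hio | hjo
        · exact h.off_diag i j (fun hij => by rw [hij] at hio; omega) (Or.inl (by omega))
        · omega
      · rfl
    rw [hprep, h0, add_zero]
    have h1 : ∀ t : Fin n, (t ≠ i ∨ t ≠ j) →
        (if t.val < o' then l.L i t * T' t t * l.U t j else 0) = 0 := by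
      intro t ht
      by_cases hto : t.val < o
      · rcases ht with ht | ht
        · rw [hL t hto ht]; simp
        · rw [hU t hto ht]; simp
      · rcases hio with hio | hjo
        · rw [h.L_upper i t (by rw [Fin.lt_def]; omega)]; simp
        · rw [h.U_lower t j (by rw [Fin.lt_def]; omega)]; simp
    split_ifs with hij
    · subst hij
      rw [Finset.sum_eq_single_of_mem i (Finset.mem_univ _) fun t _ ht => h1 t (Or.inl ht),
        if_pos (by omega), h.L_diag, h.U_diag, one_mul, mul_one]
    · refine (Finset.sum_eq_zero fun t _ => h1 t ?_).symm
      by_contra! hc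
      exact hij (hc.1.symm.trans hc.2)
  push Not at hio
  by_cases hio' : i.val < o' ∨ j.val < o'
  · rcases le_total i j with hij | hij
    · have hi : i.val < o' := by
        have : i.val ≤ j.val := hij
        omega
      rw [hsum i hio.1 hi le_rfl hij (Or.inl rfl), h.L_diag, one_mul]
      have h2 : T' i i * l.U i j = l.update T T' o i.val i j := by
        rcases hij.eq_or_lt with rfl | hlt
        · rw [h.U_diag, mul_one, h.pivot _ hio.1 hi]
        · have := h.U_drop i j hio.1 hi hlt
          rw [sub_eq_zero.1 (abs_eq_zero.1 (le_antisymm this (abs_nonneg _))),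
            mul_div_cancel₀ _ (h.pivot_ne i hio.1 hi)]
      have h3 : (if o' ≤ j.val then T' i j else 0) = 0 := by
        split_ifs with hj
        · exact h.off_diag i j (fun hij => by rw [hij] at hi; omega) (Or.inl hi)
        · rfl
      rw [h2, h3, ILULevel.update]
      ring
    · have hj : j.val < o' := by
        have : j.val ≤ i.val := hij
        omega
      rw [hsum j hio.2 hj hij le_rfl (Or.inr rfl), h.U_diag, mul_one]
      have h2 : l.L i j * T' j j = l.update T T' o j.val i j := by
        rcases hij.eq_or_lt with rfl | hlt
        · rw [h.L_diag, one_mul, h.pivot _ hio.1 hj]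
        · have := h.L_drop i j hio.2 hj hlt
          rw [sub_eq_zero.1 (abs_eq_zero.1 (le_antisymm this (abs_nonneg _))),
            div_mul_cancel₀ _ (h.pivot_ne j hio.2 hj)]
      rw [h2, if_neg hj.not_ge, ILULevel.update]
      ring
  · push Not at hio'
    rw [if_pos hio'.2, h.schur i j hio'.1 hio'.2, ILULevel.update, Finset.sum_filter]
    have h1 : (∑ t : Fin n, if t.val < o' then l.L i t * T' t t * l.U t j else 0)
        = ∑ t : Fin n, if o ≤ t.val ∧ t.val < o' then l.L i t * T' t t * l.U t j else 0 := by
      refine Finset.sum_congr rfl fun t _ => ?_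
      by_cases hto : t.val < o
      · rw [hL t hto (fun hti => by rw [hti] at hto; omega)]
        simp
      · simp [not_lt.1 hto]
    rw [h1]
    ring

lemma ILUStep.eq_mul (h : ILUStep 0 o T l o' T')
    (hT : ∀ i j : Fin n, i ≠ j → (i.val < o ∨ j.val < o) → T i j = 0) :
    T = l.W⁻¹ * l.P * l.L * T' * (l.U * l.Qᵀ * l.V⁻¹) := by
  have hW : IsUnit l.W.det := by
    rw [ILULevel.W, Matrix.det_diagonal]
    exact isUnit_iff_ne_zero.2 (Finset.prod_ne_zero_iff.2 fun i _ => (h.w_pos i).ne')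
  have hV : IsUnit l.V.det := by
    rw [ILULevel.V, Matrix.det_diagonal]
    exact isUnit_iff_ne_zero.2 (Finset.prod_ne_zero_iff.2 fun i _ => (h.v_pos i).ne')
  calc T = l.W⁻¹ * (l.P * l.Pᵀ) * l.W * T * l.V * (l.Q * l.Qᵀ) * l.V⁻¹ := by
        rw [l.P_mul_transpose, l.Q_mul_transpose, mul_one, mul_one, Matrix.nonsing_inv_mul _ hW,
          one_mul, Matrix.mul_nonsing_inv_cancel_right _ _ hV]
    _ = l.W⁻¹ * l.P * l.prep T * l.Qᵀ * l.V⁻¹ := by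
        simp only [ILULevel.prep, Matrix.mul_assoc]
    _ = _ := by
        rw [h.prep_eq hT]
        simp only [Matrix.mul_assoc]

lemma ILUChain.off_diag {d : ℕ} {ls : List (ILULevel n)} (h : ILUChain δ o T ls d T')
    (hT : ∀ i j : Fin n, i ≠ j → (i.val < o ∨ j.val < o) → T i j = 0) :
    ∀ i j : Fin n, i ≠ j → (i.val < d ∨ j.val < d) → T' i j = 0 := by
  induction h with
  | nil => exact hT
  | cons step _ ih => exact ih step.off_diag

lemma ILUChain.eq_mul {d : ℕ} {ls : List (ILULevel n)} (h : ILUChain 0 o T ls d T')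
    (hT : ∀ i j : Fin n, i ≠ j → (i.val < o ∨ j.val < o) → T i j = 0) :
    T = leftProd ls * T' * rightProd ls := by
  induction h with
  | nil => simp [leftProd, rightProd]
  | cons step _ ih =>
    conv_lhs => rw [step.eq_mul hT, ih step.off_diag]
    simp only [leftProd, rightProd, Matrix.mul_assoc]

lemma ILUChain.le {d : ℕ} {ls : List (ILULevel n)} (h : ILUChain δ o T ls d T') : o ≤ d := by
  induction h with
  | nil => exact le_rfl
  | cons step _ ih => exact step.lt.le.trans ih

lemma ILUChain.pivot_eq {d : ℕ} {ls : List (ILULevel n)} (h : ILUChain δ o T ls d T') :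
    ∀ i : Fin n, i.val < o → T' i i = T i i := by
  induction h with
  | nil => exact fun _ _ => rfl
  | cons step _ ih =>
    exact fun i hi => (ih i (hi.trans step.lt)).trans (step.old_pivot i hi)

lemma isUnit_det_leftProd {K : ℝ} : ∀ ls : List (ILULevel n),
    (∀ l ∈ ls, CondLE l.L K ∧ CondLE l.U K ∧ CondLE l.W K ∧ CondLE l.V K) →
      IsUnit (leftProd ls).det
  | [], _ => by simp [leftProd]
  | l :: ls, h => by
    have h1 := h l (by simp)
    have h2 : IsUnit l.P.det := by
      rw [← Matrix.isUnit_iff_isUnit_det]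
      exact IsUnit.of_mul_eq_one _ l.P_mul_transpose
    rw [leftProd, Matrix.det_mul, Matrix.det_mul, Matrix.det_mul]
    exact (((Matrix.isUnit_nonsing_inv_det _ h1.2.2.1.1).mul h2).mul h1.1.1).mul
      (isUnit_det_leftProd ls fun l' hl' => h l' (List.mem_cons_of_mem _ hl'))

lemma isUnit_det_rightProd {K : ℝ} : ∀ ls : List (ILULevel n),
    (∀ l ∈ ls, CondLE l.L K ∧ CondLE l.U K ∧ CondLE l.W K ∧ CondLE l.V K) →
      IsUnit (rightProd ls).det
  | [], _ => by simp [rightProd]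
  | l :: ls, h => by
    have h1 := h l (by simp)
    have h2 : IsUnit l.Qᵀ.det := by
      rw [Matrix.det_transpose, ← Matrix.isUnit_iff_isUnit_det]
      exact IsUnit.of_mul_eq_one _ l.Q_mul_transpose
    rw [rightProd, Matrix.det_mul, Matrix.det_mul, Matrix.det_mul]
    exact (isUnit_det_rightProd ls fun l' hl' => h l' (List.mem_cons_of_mem _ hl')).mul
      ((h1.2.1.1.mul h2).mul (Matrix.isUnit_nonsing_inv_det _ h1.2.2.2.1))

/-- A level on `T` gives a level on `S`, with all pivots and Schur complements multiplied by `c`,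
if the permuted and scaled matrices differ by the factor `c`. -/
lemma ILUStep.rescale (h : ILUStep δ o T l o' T') {S : Matrix (Fin n) (Fin n) ℝ} {l' : ILULevel n}
    {c : ℝ} (hc : c ≠ 0) (hp : l'.p = l.p) (hq : l'.q = l.q) (hL : l'.L = l.L) (hU : l'.U = l.U)
    (hw : ∀ i, 0 < l'.w i) (hv : ∀ i, 0 < l'.v i) (hw1 : ∀ i : Fin n, i.val < o → l'.w i = 1)
    (hv1 : ∀ i : Fin n, i.val < o → l'.v i = 1) (hprep : l'.prep S = c • l.prep T)
    (hS : ∀ i : Fin n, i.val < o → S i i = c * T i i) : ILUStep δ o S l' o' (c • T') := by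
  have hup : ∀ m i j, l'.update S (c • T') o m i j = c * l.update T T' o m i j := by
    intro m i j
    simp only [ILULevel.update, hprep, hL, hU, Matrix.smul_apply, smul_eq_mul, mul_sub,
      Finset.mul_sum]
    congr 1
    exact Finset.sum_congr rfl fun t _ => by ring
  refine
    { lt := h.lt, le := h.le
      p_fix := hp ▸ h.p_fix, q_fix := hq ▸ h.q_fix
      w_pos := hw, v_pos := hv, w_one := hw1, v_one := hv1
      L_diag := hL ▸ h.L_diag, U_diag := hU ▸ h.U_diag
      L_upper := hL ▸ h.L_upper, U_lower := hU ▸ h.U_lower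
      L_outside := hL ▸ h.L_outside, U_outside := hU ▸ h.U_outside
      off_diag := ?_, old_pivot := ?_, pivot := ?_, pivot_ne := ?_, schur := ?_
      L_drop := ?_, U_drop := ?_ }
  · intro i j h1 h2
    rw [Matrix.smul_apply, h.off_diag i j h1 h2, smul_zero]
  · intro i hi
    rw [Matrix.smul_apply, h.old_pivot i hi, hS i hi, smul_eq_mul]
  · intro k h1 h2
    rw [hup, Matrix.smul_apply, h.pivot k h1 h2, smul_eq_mul]
  · intro k h1 h2
    exact mul_ne_zero hc (h.pivot_ne k h1 h2)
  · intro i j h1 h2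
    rw [hup, Matrix.smul_apply, h.schur i j h1 h2, smul_eq_mul]
  · intro i k h1 h2 h3
    rw [hup, hL, Matrix.smul_apply, smul_eq_mul, mul_div_mul_left _ _ hc]
    exact h.L_drop i k h1 h2 h3
  · intro i k h1 h2 h3
    rw [hup, hU, Matrix.smul_apply, smul_eq_mul, mul_div_mul_left _ _ hc]
    exact h.U_drop i k h1 h2 h3

lemma ILUStep.smul (h : ILUStep δ o T l o' T') {c : ℝ} (hc : c ≠ 0) :
    ILUStep δ o (c • T) l o' (c • T') :=
  h.rescale hc rfl rfl rfl rfl h.w_pos h.v_pos h.w_one h.v_one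
    (by simp [ILULevel.prep]) fun _ _ => rfl

lemma ILUChain.smul {d : ℕ} {ls : List (ILULevel n)} (h : ILUChain δ o T ls d T') {c : ℝ}
    (hc : c ≠ 0) : ILUChain δ o (c • T) ls d (c • T') := by
  induction h with
  | nil => exact .nil _ _
  | cons step _ ih => exact .cons (step.smul hc) ih

end Levels

/-! ### Limits of multilevel factorizations -/

section Limits

variable {ι : Type*} {n : ℕ}

/-- Convergence of the levels `l i` along a filter to `l₀`: the permutations are eventually
those of `l₀`, and all the real data converge. -/
structure ILULevel.TendsTo (l : ι → ILULevel n) (F : Filter ι) (l₀ : ILULevel n) : Prop where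
  p : ∀ᶠ i in F, (l i).p = l₀.p
  q : ∀ᶠ i in F, (l i).q = l₀.q
  w : ∀ a, Tendsto (fun i => (l i).w a) F (𝓝 (l₀.w a))
  v : ∀ a, Tendsto (fun i => (l i).v a) F (𝓝 (l₀.v a))
  L : Tendsto (fun i => (l i).L) F (𝓝 l₀.L)
  U : Tendsto (fun i => (l i).U) F (𝓝 l₀.U)

lemma ILULevel.TendsTo.prep {F : Filter ι} {l : ι → ILULevel n} {l₀ : ILULevel n}
    (h : ILULevel.TendsTo l F l₀) {T : ι → Matrix (Fin n) (Fin n) ℝ} {T₀ : Matrix (Fin n) (Fin n) ℝ}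
    (hT : Tendsto T F (𝓝 T₀)) (a b : Fin n) :
    Tendsto (fun i => (l i).prep (T i) a b) F (𝓝 (l₀.prep T₀ a b)) := by
  rw [ILULevel.prep_apply]
  refine Tendsto.congr' ?_ (((h.w (l₀.p.symm a)).mul
    (tendsto_matrix_iff.1 hT (l₀.p.symm a) (l₀.q.symm b))).mul (h.v (l₀.q.symm b)))
  filter_upwards [h.p, h.q] with i hp hq
  rw [ILULevel.prep_apply, hp, hq]

lemma ILULevel.TendsTo.W {F : Filter ι} {l : ι → ILULevel n} {l₀ : ILULevel n}
    (h : ILULevel.TendsTo l F l₀) : Tendsto (fun i => (l i).W) F (𝓝 l₀.W) :=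
  (continuous_id.matrix_diagonal.tendsto l₀.w).comp (tendsto_pi_nhds.2 h.w)

lemma ILULevel.TendsTo.V {F : Filter ι} {l : ι → ILULevel n} {l₀ : ILULevel n}
    (h : ILULevel.TendsTo l F l₀) : Tendsto (fun i => (l i).V) F (𝓝 l₀.V) :=
  (continuous_id.matrix_diagonal.tendsto l₀.v).comp (tendsto_pi_nhds.2 h.v)

lemma ILULevel.TendsTo.P {F : Filter ι} {l : ι → ILULevel n} {l₀ : ILULevel n}
    (h : ILULevel.TendsTo l F l₀) : Tendsto (fun i => (l i).P) F (𝓝 l₀.P) :=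
  tendsto_const_nhds.congr' (h.p.mono fun i hi => by simp only [ILULevel.P, hi])

lemma ILULevel.TendsTo.Q {F : Filter ι} {l : ι → ILULevel n} {l₀ : ILULevel n}
    (h : ILULevel.TendsTo l F l₀) : Tendsto (fun i => (l i).Q) F (𝓝 l₀.Q) :=
  tendsto_const_nhds.congr' (h.q.mono fun i hi => by simp only [ILULevel.Q, hi])

/-- The updates converge as soon as the pivots do. -/
lemma ILULevel.TendsTo.update {F : Filter ι} {l : ι → ILULevel n} {l₀ : ILULevel n}
    (h : ILULevel.TendsTo l F l₀) {T T' : ι → Matrix (Fin n) (Fin n) ℝ}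
    {T₀ : Matrix (Fin n) (Fin n) ℝ} (hT : Tendsto T F (𝓝 T₀)) {t₀ : Matrix (Fin n) (Fin n) ℝ}
    {o c : ℕ} (ht : ∀ t : Fin n, t.val < c → Tendsto (fun i => T' i t t) F (𝓝 (t₀ t t)))
    (a b : Fin n) :
    Tendsto (fun i => (l i).update (T i) (T' i) o c a b) F (𝓝 (l₀.update T₀ t₀ o c a b)) := by
  refine (h.prep hT a b).sub (tendsto_finsetSum _ fun t htm => ?_)
  have htc := (Finset.mem_filter.1 htm).2.2
  exact ((tendsto_matrix_iff.1 h.L a t).mul (ht t htc)).mul (tendsto_matrix_iff.1 h.U t b)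

lemma ILULevel.exists_tendsTo (u : Ultrafilter ι) {l : ι → ILULevel n} {B : ℝ}
    (hL : ∀ᶠ i in (u : Filter ι), ∀ a b, |(l i).L a b| ≤ B)
    (hU : ∀ᶠ i in (u : Filter ι), ∀ a b, |(l i).U a b| ≤ B)
    (hw : ∀ᶠ i in (u : Filter ι), ∀ a, |(l i).w a| ≤ B)
    (hv : ∀ᶠ i in (u : Filter ι), ∀ a, |(l i).v a| ≤ B) :
    ∃ l₀, ILULevel.TendsTo l u l₀ := by
  obtain ⟨p, hp⟩ := u.exists_eventually_eq fun i => (l i).p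
  obtain ⟨q, hq⟩ := u.exists_eventually_eq fun i => (l i).q
  choose w hw' using fun a => u.exists_tendsto_of_abs_le (hw.mono fun i hi => hi a)
  choose v hv' using fun a => u.exists_tendsto_of_abs_le (hv.mono fun i hi => hi a)
  obtain ⟨L, hL'⟩ := exists_tendsto_matrix fun a b =>
    u.exists_tendsto_of_abs_le (hL.mono fun i hi => hi a b)
  obtain ⟨U, hU'⟩ := exists_tendsto_matrix fun a b =>
    u.exists_tendsto_of_abs_le (hU.mono fun i hi => hi a b)
  exact ⟨⟨p, q, w, v, L, U⟩, hp, hq, hw', hv', hL', hU'⟩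

/-- Steps whose droppings tend to `0`, with convergent level data and pivots bounded away from `0`
and infinity, converge to an exact step. -/
lemma ILUStep.exists_limit (u : Ultrafilter ι) {o o' : ℕ} {δ : ι → ℝ} (hδ : Tendsto δ u (𝓝 0))
    {T T' : ι → Matrix (Fin n) (Fin n) ℝ} {T₀ : Matrix (Fin n) (Fin n) ℝ} (hT : Tendsto T u (𝓝 T₀))
    {l : ι → ILULevel n} {l₀ : ILULevel n} (hl : ILULevel.TendsTo l u l₀)
    (h : ∀ᶠ i in (u : Filter ι), ILUStep (δ i) o (T i) (l i) o' (T' i))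
    (hw : ∀ a, l₀.w a ≠ 0) (hv : ∀ a, l₀.v a ≠ 0) {c B : ℝ} (hc : 0 < c)
    (hp : ∀ᶠ i in (u : Filter ι), ∀ k : Fin n, k.val < o' → c ≤ |T' i k k| ∧ |T' i k k| ≤ B) :
    ∃ T₀', ILUStep 0 o T₀ l₀ o' T₀' ∧ Tendsto T' u (𝓝 T₀') := by
  obtain ⟨i₀, hi₀⟩ := h.exists
  -- the pivots converge because they are bounded
  have hpiv : ∀ k : Fin n, ∃ x, k.val < o' → Tendsto (fun i => T' i k k) u (𝓝 x) := by
    intro k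
    by_cases hk : k.val < o'
    · obtain ⟨x, hx⟩ := u.exists_tendsto_of_abs_le (hp.mono fun i hi => (hi k hk).2)
      exact ⟨x, fun _ => hx⟩
    · exact ⟨0, fun h => absurd h hk⟩
  choose t ht using hpiv
  have hup : ∀ m, m ≤ o' → ∀ a b, Tendsto (fun i => (l i).update (T i) (T' i) o m a b) u
      (𝓝 (l₀.update T₀ (Matrix.diagonal t) o m a b)) := fun m hm a b =>
    hl.update hT (fun s hs => by simpa using ht s (hs.trans_le hm)) a b
  obtain ⟨T₀', hT'⟩ : ∃ T₀', Tendsto T' u (𝓝 T₀') := by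
    refine exists_tendsto_matrix fun a b => ?_
    by_cases hab : a.val < o' ∨ b.val < o'
    · by_cases h' : a = b
      · subst h'
        exact ⟨t a, ht a (by simpa using hab)⟩
      · exact ⟨0, tendsto_const_nhds.congr' (h.mono fun i hi => (hi.off_diag a b h' hab).symm)⟩
    · push Not at hab
      exact ⟨_, (hup o' le_rfl a b).congr' (h.mono fun i hi => (hi.schur a b hab.1 hab.2).symm)⟩
  have hT'' := fun a b => tendsto_matrix_iff.1 hT' a b
  have hup' : ∀ m a b, Tendsto (fun i => (l i).update (T i) (T' i) o m a b) u
      (𝓝 (l₀.update T₀ T₀' o m a b)) := fun m a b => hl.update hT (fun s _ => hT'' s s) a b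
  have hL := fun a b => tendsto_matrix_iff.1 hl.L a b
  have hU := fun a b => tendsto_matrix_iff.1 hl.U a b
  have hne : ∀ k : Fin n, k.val < o' → T₀' k k ≠ 0 := by
    intro k hk
    have := ge_of_tendsto (hT'' k k).abs (hp.mono fun i hi => (hi k hk).1)
    exact abs_pos.1 (hc.trans_le this)
  have key : ∀ {f g : ι → ℝ} {x y : ℝ}, Tendsto f u (𝓝 x) → Tendsto g u (𝓝 y) →
      (∀ᶠ i in (u : Filter ι), f i = g i) → x = y := fun hf hg hfg =>
    tendsto_nhds_unique_of_eventuallyEq hf hg hfg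
  refine ⟨T₀',
    { lt := hi₀.lt, le := hi₀.le
      p_fix := ?_, q_fix := ?_, w_pos := ?_, v_pos := ?_, w_one := ?_, v_one := ?_
      L_diag := ?_, U_diag := ?_, L_upper := ?_, U_lower := ?_, L_outside := ?_, U_outside := ?_
      off_diag := ?_, old_pivot := ?_, pivot := ?_, pivot_ne := ?_, schur := ?_
      L_drop := ?_, U_drop := ?_ }, hT'⟩
  · intro a ha
    obtain ⟨i, hi, hi'⟩ := (h.and hl.p).exists
    exact hi' ▸ hi.p_fix a ha
  · intro a ha
    obtain ⟨i, hi, hi'⟩ := (h.and hl.q).exists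
    exact hi' ▸ hi.q_fix a ha
  · exact fun a => (ge_of_tendsto (hl.w a) (h.mono fun i hi => (hi.w_pos a).le)).lt_of_ne' (hw a)
  · exact fun a => (ge_of_tendsto (hl.v a) (h.mono fun i hi => (hi.v_pos a).le)).lt_of_ne' (hv a)
  · exact fun a ha => key (hl.w a) tendsto_const_nhds (h.mono fun i hi => hi.w_one a ha)
  · exact fun a ha => key (hl.v a) tendsto_const_nhds (h.mono fun i hi => hi.v_one a ha)
  · exact fun a => key (hL a a) tendsto_const_nhds (h.mono fun i hi => hi.L_diag a)
  · exact fun a => key (hU a a) tendsto_const_nhds (h.mono fun i hi => hi.U_diag a)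
  · exact fun a b hab => key (hL a b) tendsto_const_nhds (h.mono fun i hi => hi.L_upper a b hab)
  · exact fun a b hab => key (hU a b) tendsto_const_nhds (h.mono fun i hi => hi.U_lower a b hab)
  · exact fun a b h1 h2 =>
      key (hL a b) tendsto_const_nhds (h.mono fun i hi => hi.L_outside a b h1 h2)
  · exact fun a b h1 h2 =>
      key (hU a b) tendsto_const_nhds (h.mono fun i hi => hi.U_outside a b h1 h2)
  · exact fun a b h1 h2 =>
      key (hT'' a b) tendsto_const_nhds (h.mono fun i hi => hi.off_diag a b h1 h2)
  · exact fun a ha => key (hT'' a a) (tendsto_matrix_iff.1 hT a a)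
      (h.mono fun i hi => hi.old_pivot a ha)
  · exact fun k h1 h2 => key (hT'' k k) (hup' k k k) (h.mono fun i hi => hi.pivot k h1 h2)
  · exact fun k _ h2 => hne k h2
  · exact fun a b h1 h2 => key (hT'' a b) (hup' o' a b) (h.mono fun i hi => hi.schur a b h1 h2)
  · exact fun a k h1 h2 h3 => le_of_tendsto_of_tendsto
      ((hL a k).sub ((hup' k a k).div (hT'' k k) (hne k h2))).abs hδ
      (h.mono fun i hi => hi.L_drop a k h1 h2 h3)
  · exact fun k b h1 h2 h3 => le_of_tendsto_of_tendsto
      ((hU k b).sub ((hup' k k b).div (hT'' k k) (hne k h2))).abs hδ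
      (h.mono fun i hi => hi.U_drop k b h1 h2 h3)

/-- A unit lower triangular matrix fixes the last unit vector. -/
lemma ILUStep.norm_L_le {δ K : ℝ} {o o' : ℕ} {T T' : Matrix (Fin n) (Fin n) ℝ} {l : ILULevel n}
    (h : ILUStep δ o T l o' T') (hK : CondLE l.L K) : ‖l.L‖ ≤ K := by
  have hn : 0 < n := by have := h.lt; have := h.le; omega
  refine hK.norm_le_of_mulVec_eq (i := ⟨n - 1, by omega⟩) ?_
  ext a
  rw [Matrix.mulVec_single_one, Matrix.col_apply]
  by_cases ha : a = ⟨n - 1, by omega⟩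
  · subst ha
    rw [h.L_diag, Pi.single_eq_same]
  · rw [Pi.single_eq_of_ne ha, h.L_upper]
    rw [Fin.ext_iff] at ha
    rw [Fin.lt_def]
    have := a.2
    simp only at ha ⊢
    omega

/-- A unit upper triangular matrix fixes the first unit vector. -/
lemma ILUStep.norm_U_le {δ K : ℝ} {o o' : ℕ} {T T' : Matrix (Fin n) (Fin n) ℝ} {l : ILULevel n}
    (h : ILUStep δ o T l o' T') (hK : CondLE l.U K) : ‖l.U‖ ≤ K := by
  have hn : 0 < n := by have := h.lt; have := h.le; omega
  refine hK.norm_le_of_mulVec_eq (i := ⟨0, hn⟩) ?_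
  ext a
  rw [Matrix.mulVec_single_one, Matrix.col_apply]
  by_cases ha : a = ⟨0, hn⟩
  · subst ha
    rw [h.U_diag, Pi.single_eq_same]
  · rw [Pi.single_eq_of_ne ha, h.U_lower]
    rw [Fin.ext_iff] at ha
    rw [Fin.lt_def]
    simp only at ha ⊢
    omega

lemma ILUChain.eq_nil_or_exists_cons {δ : ℝ} {o d : ℕ} {T T'' : Matrix (Fin n) (Fin n) ℝ}
    {ls : List (ILULevel n)} (h : ILUChain δ o T ls d T'') :
    (ls = [] ∧ d = o ∧ T'' = T) ∨ ∃ l m o' T', ls = l :: m ∧ ILUStep δ o T l o' T' ∧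
      ILUChain δ o' T' m d T'' := by
  cases h with
  | nil => exact Or.inl ⟨rfl, rfl, rfl⟩
  | cons step rest => exact Or.inr ⟨_, _, _, _, rfl, step, rest⟩

/-- The factors of a level have condition number at most `K`, and the free scalar factors in the
row and column scalings are fixed by some entries equal to `1`. -/
def ILULevel.IsNormalized (l : ILULevel n) (K : ℝ) : Prop :=
  (CondLE l.L K ∧ CondLE l.U K ∧ CondLE l.W K ∧ CondLE l.V K) ∧ (∃ a, l.w a = 1) ∧ ∃ a, l.v a = 1

lemma abs_bounds_of_condLE_diagonal {w : Fin n → ℝ} {K : ℝ} (h : CondLE (Matrix.diagonal w) K)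
    (h1 : ∃ a, w a = 1) (a : Fin n) : 1 ≤ K * |w a| ∧ |w a| ≤ K := by
  obtain ⟨b, hb⟩ := h1
  have h2 := h.diagonal_abs_le b a
  have h3 := h.diagonal_abs_le a b
  rw [hb, abs_one] at h2 h3
  exact ⟨h2, by simpa using h3⟩

/-- Compactness of the set of multilevel factorizations: if the droppings tend to `0`, the
levels are normalized and the pivots are bounded away from `0` and infinity, then along an
ultrafilter the factorizations converge to one without dropping. -/
lemma ILUChain.exists_limit (u : Ultrafilter ι) {δ : ι → ℝ} (hδ : Tendsto δ u (𝓝 0)) {K c B : ℝ}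
    (hc : 0 < c) {d : ℕ} {T'' : ι → Matrix (Fin n) (Fin n) ℝ}
    (hp : ∀ᶠ i in (u : Filter ι), ∀ k : Fin n, k.val < d → c ≤ |T'' i k k| ∧ |T'' i k k| ≤ B)
    (N : ℕ) : ∀ {o : ℕ}, n - o = N → ∀ {T : ι → Matrix (Fin n) (Fin n) ℝ}
      {T₀ : Matrix (Fin n) (Fin n) ℝ}, Tendsto T u (𝓝 T₀) → ∀ {ls : ι → List (ILULevel n)},
      (∀ᶠ i in (u : Filter ι), ILUChain (δ i) o (T i) (ls i) d (T'' i)) →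
      (∀ᶠ i in (u : Filter ι), ∀ l ∈ ls i, l.IsNormalized K) →
      ∃ (ls₀ : List (ILULevel n)) (T₀'' : Matrix (Fin n) (Fin n) ℝ),
        ILUChain 0 o T₀ ls₀ d T₀'' ∧
        (∀ l ∈ ls₀, CondLE l.L K ∧ CondLE l.U K ∧ CondLE l.W K ∧ CondLE l.V K) ∧
        Tendsto T'' u (𝓝 T₀'') ∧
        Tendsto (fun i => leftProd (ls i)) u (𝓝 (leftProd ls₀)) ∧
        Tendsto (fun i => rightProd (ls i)) u (𝓝 (rightProd ls₀)) := by
  induction N using Nat.strong_induction_on with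
  | _ N ih =>
  intro o hN T T₀ hT ls hls hgood
  have hcases : ∀ᶠ i in (u : Filter ι), (ls i = [] ∧ d = o ∧ T'' i = T i) ∨
      ∃ x : ILULevel n × List (ILULevel n) × Fin (n + 1) × Matrix (Fin n) (Fin n) ℝ,
        ls i = x.1 :: x.2.1 ∧ ILUStep (δ i) o (T i) x.1 x.2.2.1 x.2.2.2 ∧
        ILUChain (δ i) x.2.2.1 x.2.2.2 x.2.1 d (T'' i) := by
    filter_upwards [hls] with i hi
    rcases hi.eq_nil_or_exists_cons with h | ⟨l, m, o', T', h1, h2, h3⟩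
    · exact Or.inl h
    · exact Or.inr ⟨⟨l, m, ⟨o', Nat.lt_succ_of_le h2.le⟩, T'⟩, h1, h2, h3⟩
  rcases Ultrafilter.eventually_or.1 hcases with hnil | hcons
  · obtain ⟨i₀, -, rfl, -⟩ := hnil.exists
    refine ⟨[], T₀, .nil _ _, by simp, hT.congr' (hnil.mono fun i hi => hi.2.2.symm), ?_, ?_⟩
    · exact tendsto_const_nhds.congr' (hnil.mono fun i hi => by simp only [hi.1])
    · exact tendsto_const_nhds.congr' (hnil.mono fun i hi => by simp only [hi.1])
  obtain ⟨x, hx⟩ := hcons.choice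
  -- along the ultrafilter, the first levels eliminate the same number `o'` of pivots
  obtain ⟨o', ho'⟩ := u.exists_eventually_eq fun i => (x i).2.2.1
  set l := fun i => (x i).1 with hl
  set ls' := fun i => (x i).2.1 with hls'
  set T' := fun i => (x i).2.2.2
  have hstep : ∀ᶠ i in (u : Filter ι), ILUStep (δ i) o (T i) (l i) o' (T' i) := by
    filter_upwards [hx, ho'] with i hi hi'
    exact hi' ▸ hi.2.1
  have hrest : ∀ᶠ i in (u : Filter ι), ILUChain (δ i) o' (T' i) (ls' i) d (T'' i) := by
    filter_upwards [hx, ho'] with i hi hi'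
    exact hi' ▸ hi.2.2
  have hlgood : ∀ᶠ i in (u : Filter ι), (l i).IsNormalized K := by
    filter_upwards [hx, hgood] with i hi hi'
    exact hi' _ (by rw [hi.1]; simp [hl])
  have hls'good : ∀ᶠ i in (u : Filter ι), ∀ m ∈ ls' i, m.IsNormalized K := by
    filter_upwards [hx, hgood] with i hi hi' m hm
    exact hi' _ (by rw [hi.1]; exact List.mem_cons_of_mem _ hm)
  obtain ⟨i₀, hs₀, hr₀⟩ := (hstep.and hrest).exists
  have hod : o'.val ≤ d := hr₀.le
  have hoo : o < o'.val := hs₀.lt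
  have hon : o'.val ≤ n := hs₀.le
  obtain ⟨l₀, hl₀⟩ := ILULevel.exists_tendsTo u (l := l) (B := K)
    (by filter_upwards [hstep, hlgood] with i hi hi' a b
        exact (abs_apply_le_norm _ a b).trans (hi.norm_L_le hi'.1.1))
    (by filter_upwards [hstep, hlgood] with i hi hi' a b
        exact (abs_apply_le_norm _ a b).trans (hi.norm_U_le hi'.1.2.1))
    (by filter_upwards [hlgood] with i hi a
        exact (abs_bounds_of_condLE_diagonal hi.1.2.2.1 hi.2.1 a).2)
    (by filter_upwards [hlgood] with i hi a
        exact (abs_bounds_of_condLE_diagonal hi.1.2.2.2 hi.2.2 a).2)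
  -- the bound `1 ≤ K |w a|` keeps the limits of the scalings away from `0`
  have hw₀ : ∀ a, l₀.w a ≠ 0 := by
    intro a h0
    have := ge_of_tendsto ((hl₀.w a).abs.const_mul K) (hlgood.mono fun i hi =>
      (abs_bounds_of_condLE_diagonal hi.1.2.2.1 hi.2.1 a).1)
    rw [h0] at this
    norm_num at this
  have hv₀ : ∀ a, l₀.v a ≠ 0 := by
    intro a h0
    have := ge_of_tendsto ((hl₀.v a).abs.const_mul K) (hlgood.mono fun i hi =>
      (abs_bounds_of_condLE_diagonal hi.1.2.2.2 hi.2.2 a).1)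
    rw [h0] at this
    norm_num at this
  obtain ⟨T₀', hstep₀, hT₀'⟩ := ILUStep.exists_limit u hδ hT hl₀ hstep hw₀ hv₀ hc
    (B := B) (by
      filter_upwards [hrest, hp] with i hi hi' k hk
      rw [← hi.pivot_eq k hk]
      exact hi' k (hk.trans_le hod))
  obtain ⟨ls₀, T₀'', hchain, hcond, hlim, hleft, hright⟩ :=
    ih (n - o'.val) (by omega) rfl hT₀' hrest hls'good
  have a₀ : Fin n := ⟨0, by omega⟩
  have hL : CondLE l₀.L K := by
    refine CondLE.of_tendsto_of_ne_zero hl₀.L (hlgood.mono fun i hi => hi.1.1) fun h0 => ?_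
    have := hstep₀.L_diag a₀
    simp [h0] at this
  have hU : CondLE l₀.U K := by
    refine CondLE.of_tendsto_of_ne_zero hl₀.U (hlgood.mono fun i hi => hi.1.2.1) fun h0 => ?_
    have := hstep₀.U_diag a₀
    simp [h0] at this
  have hW : CondLE l₀.W K := by
    refine CondLE.of_tendsto_of_ne_zero hl₀.W (hlgood.mono fun i hi => hi.1.2.2.1) fun h0 => ?_
    exact hw₀ a₀ (by simpa [ILULevel.W] using congrFun (congrFun h0 a₀) a₀)
  have hV : CondLE l₀.V K := by
    refine CondLE.of_tendsto_of_ne_zero hl₀.V (hlgood.mono fun i hi => hi.1.2.2.2) fun h0 => ?_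
    exact hv₀ a₀ (by simpa [ILULevel.V] using congrFun (congrFun h0 a₀) a₀)
  refine ⟨l₀ :: ls₀, T₀'', .cons hstep₀ hchain, ?_, hlim, ?_, ?_⟩
  · intro m hm
    rcases List.mem_cons.1 hm with rfl | hm
    · exact ⟨hL, hU, hW, hV⟩
    · exact hcond m hm
  · refine Tendsto.congr' (hx.mono fun i hi => ?_)
      ((((tendsto_matrix_inv hl₀.W hW.1).mul hl₀.P).mul hl₀.L).mul hleft)
    simp only [hi.1, leftProd, hl, hls']
  · have hQ : Tendsto (fun i => (l i).Qᵀ) u (𝓝 l₀.Qᵀ) :=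
      (continuous_id.matrix_transpose.tendsto l₀.Q).comp hl₀.Q
    refine Tendsto.congr' (hx.mono fun i hi => ?_)
      (hright.mul ((hl₀.U.mul hQ).mul (tendsto_matrix_inv hl₀.V hV.1)))
    simp only [hi.1, rightProd, hl, hls']

end Limits

/-! ### Block diagonal matrices -/

section Blocks

variable {d n : ℕ}

lemma blockDiag_mul (h : d ≤ n) (X X' : Matrix (Fin d) (Fin d) ℝ)
    (Y Y' : Matrix (Fin (n - d)) (Fin (n - d)) ℝ) :
    blockDiag h X Y * blockDiag h X' Y' = blockDiag h (X * X') (Y * Y') := by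
  simp only [blockDiag, Matrix.reindex_apply, Matrix.submatrix_mul_equiv,
    Matrix.fromBlocks_multiply, Matrix.mul_zero, Matrix.zero_mul, add_zero, zero_add]

lemma blockDiag_one_one (h : d ≤ n) : blockDiag h 1 1 = 1 := by
  simp [blockDiag]

lemma blockDiag_transpose (h : d ≤ n) (X : Matrix (Fin d) (Fin d) ℝ)
    (Y : Matrix (Fin (n - d)) (Fin (n - d)) ℝ) : (blockDiag h X Y)ᵀ = blockDiag h Xᵀ Yᵀ := by
  simp [blockDiag, Matrix.fromBlocks_transpose]

lemma blockDiag_smul (h : d ≤ n) (c : ℝ) (X : Matrix (Fin d) (Fin d) ℝ)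
    (Y : Matrix (Fin (n - d)) (Fin (n - d)) ℝ) :
    blockDiag h (c • X) (c • Y) = c • blockDiag h X Y := by
  ext i j
  simp only [blockDiag, Matrix.reindex_apply, Matrix.submatrix_apply, Matrix.smul_apply]
  rcases (splitEquiv h).symm i with a | a <;> rcases (splitEquiv h).symm j with b | b <;> simp

@[simp] lemma splitEquiv_inl_val (h : d ≤ n) (i : Fin d) :
    (splitEquiv h (Sum.inl i)).val = i.val := by
  simp [splitEquiv]

@[simp] lemma splitEquiv_inr_val (h : d ≤ n) (i : Fin (n - d)) :
    (splitEquiv h (Sum.inr i)).val = d + i.val := by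
  simp [splitEquiv]

lemma splitEquiv_inl (h : d ≤ n) (i : Fin d) : splitEquiv h (Sum.inl i) = Fin.castLE h i :=
  Fin.ext (by simp)

lemma blockDiag_one_idBlock (h : d ≤ n) (k : ℕ) :
    blockDiag h 1 (idBlock (n - d) k) = idBlock n (d + k) := by
  ext i j
  obtain ⟨i, rfl⟩ := (splitEquiv h).surjective i
  obtain ⟨j, rfl⟩ := (splitEquiv h).surjective j
  have hd : ∀ a : Fin d, a.val < d + k := fun a => by omega
  rcases i with i | i <;> rcases j with j | j <;>
    simp [blockDiag, idBlock, Matrix.diagonal_apply, Matrix.one_apply, hd]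

lemma rank_idBlock {k : ℕ} (h : k ≤ n) : (idBlock n k).rank = k := by
  rw [idBlock, Matrix.rank_diagonal, Fintype.card_subtype]
  simp only [ne_eq, ite_eq_right_iff, one_ne_zero, imp_false, not_not]
  rw [Fin.card_filter_val_lt, min_eq_right h]

lemma idBlock_mul_apply (k : ℕ) (M : Matrix (Fin n) (Fin n) ℝ) (i j : Fin n) :
    (idBlock n k * M) i j = if i.val < k then M i j else 0 := by
  rw [idBlock, Matrix.diagonal_mul]
  split_ifs <;> simp

lemma tendsto_blockDiag {ι : Type*} {F : Filter ι} (h : d ≤ n)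
    {X : ι → Matrix (Fin d) (Fin d) ℝ} {X₀ : Matrix (Fin d) (Fin d) ℝ}
    {Y : ι → Matrix (Fin (n - d)) (Fin (n - d)) ℝ} {Y₀ : Matrix (Fin (n - d)) (Fin (n - d)) ℝ}
    (hX : Tendsto X F (𝓝 X₀)) (hY : Tendsto Y F (𝓝 Y₀)) :
    Tendsto (fun i => blockDiag h (X i) (Y i)) F (𝓝 (blockDiag h X₀ Y₀)) := by
  have hc : Continuous fun p : Matrix (Fin d) (Fin d) ℝ × Matrix (Fin (n - d)) (Fin (n - d)) ℝ =>
      blockDiag h p.1 p.2 :=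
    (continuous_fst.matrix_fromBlocks continuous_const continuous_const
      continuous_snd).matrix_reindex _ _
  exact (hc.tendsto (X₀, Y₀)).comp (hX.prodMk_nhds hY)

end Blocks

/-! ### QR factorization with column pivoting -/

section QR

variable {s : ℕ} {S : Matrix (Fin s) (Fin s) ℝ} {π : Equiv.Perm (Fin s)}
  {Q R : Matrix (Fin s) (Fin s) ℝ}

lemma IsQRCP.orth' (h : IsQRCP S π Q R) : Q * Qᵀ = 1 :=
  mul_eq_one_comm.1 h.orth

lemma IsQRCP.R_eq (h : IsQRCP S π Q R) : R = Qᵀ * (S * π.permMatrix ℝ) := by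
  rw [h.eq, ← Matrix.mul_assoc, h.orth, Matrix.one_mul]

lemma permMatrix_mul_transpose_self (π : Equiv.Perm (Fin s)) :
    π.permMatrix ℝ * (π.permMatrix ℝ)ᵀ = 1 := by
  rw [Matrix.transpose_permMatrix, ← Matrix.permMatrix_mul]
  simp

lemma IsQRCP.S_eq (h : IsQRCP S π Q R) : S = Q * R * (π.permMatrix ℝ)ᵀ := by
  rw [← h.eq, Matrix.mul_assoc, permMatrix_mul_transpose_self, Matrix.mul_one]

/-- Column pivoting reveals the rank: the diagonal entries of `R` are nonzero up to some
index `k`, and all rows from there on vanish. -/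
lemma IsQRCP.exists_diag_ne_zero (h : IsQRCP S π Q R) :
    ∃ k ≤ s, (∀ i : Fin s, i.val < k → R i i ≠ 0) ∧ ∀ i j : Fin s, k ≤ i.val → R i j = 0 := by
  classical
  have hex : ∃ k, ∀ i : Fin s, i.val = k → R i i = 0 :=
    ⟨s, fun i hi => absurd i.2 (by omega)⟩
  refine ⟨Nat.find hex, Nat.find_min' hex fun i hi => absurd i.2 (by omega), ?_, ?_⟩
  · intro i hi h0
    exact Nat.find_min hex hi fun j hj => by rwa [Fin.ext hj]
  · intro i j hi
    rcases lt_or_ge j i with hji | hij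
    · exact h.upper i j hji
    set m : Fin s := ⟨Nat.find hex, hi.trans_lt i.2⟩
    have h0 : R m m = 0 := Nat.find_spec hex m rfl
    have h1 := h.pivoting m j ((show m ≤ i from hi).trans hij)
    rw [h0] at h1
    have h2 := Finset.single_le_sum (f := fun t => R t j ^ 2) (fun t _ => sq_nonneg _)
      (Finset.mem_Ici.2 (show m ≤ i from hi))
    have h3 : R i j ^ 2 ≤ 0 := by simpa using h2.trans h1
    exact pow_eq_zero_iff two_ne_zero |>.1 (le_antisymm h3 (sq_nonneg _))

lemma det_leadingBlock (hR : ∀ i j, j < i → R i j = 0) {k : ℕ} (hk : k ≤ s) :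
    (leadingBlock hk R).det = ∏ i : Fin k, R (Fin.castLE hk i) (Fin.castLE hk i) := by
  rw [Matrix.det_of_isUpperTriangular]
  · rfl
  · intro i j hij
    exact hR _ _ hij

lemma mul_paddedInv {k : ℕ} (hk : k ≤ s) (hdet : IsUnit (leadingBlock hk R).det)
    (h0 : ∀ i j : Fin s, k ≤ i.val → R i j = 0) : R * paddedInv hk R = idBlock s k := by
  obtain ⟨B, h1⟩ : ∃ B, R = Matrix.reindex (splitEquiv hk) (splitEquiv hk)
      (Matrix.fromBlocks (leadingBlock hk R) B 0 0) := by
    refine ⟨R.submatrix (fun i => splitEquiv hk (Sum.inl i))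
      (fun j => splitEquiv hk (Sum.inr j)), ?_⟩
    ext i j
    obtain ⟨i, rfl⟩ := (splitEquiv hk).surjective i
    obtain ⟨j, rfl⟩ := (splitEquiv hk).surjective j
    rcases i with i | i
    · rcases j with j | j <;> simp [leadingBlock, ← splitEquiv_inl hk]
    · rw [h0 _ _ (by simp)]
      rcases j with j | j <;> simp
  have h2 := blockDiag_one_idBlock hk 0
  have h3 : idBlock (s - k) 0 = 0 := by simp [idBlock]
  rw [h3, add_zero] at h2
  rw [← h2]
  rw [paddedInv, blockDiag, blockDiag]
  generalize leadingBlock hk R = N at *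
  rw [h1]
  simp only [Matrix.reindex_apply, Matrix.submatrix_mul_equiv, Matrix.fromBlocks_multiply,
    Matrix.mul_zero, Matrix.zero_mul, add_zero, Matrix.mul_nonsing_inv _ hdet]

/-- With `k` the rank of `S`, the leading `k × k` block of `R` is nonsingular and the other rows
of `R` vanish. -/
lemma IsQRCP.of_rank (h : IsQRCP S π Q R) :
    (∀ i : Fin s, i.val < S.rank → R i i ≠ 0) ∧ ∀ i j : Fin s, S.rank ≤ i.val → R i j = 0 := by
  obtain ⟨k, hk, h1, h2⟩ := h.exists_diag_ne_zero
  have hdet : IsUnit (leadingBlock hk R).det := by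
    rw [det_leadingBlock h.upper, isUnit_iff_ne_zero, Finset.prod_ne_zero_iff]
    exact fun i _ => h1 _ (by simp)
  have h3 := mul_paddedInv hk hdet h2
  have h4 : idBlock s k * R = R := by
    ext i j
    rw [idBlock_mul_apply]
    split_ifs with hi
    · rfl
    · rw [h2 i j (not_lt.1 hi)]
  have hR : R.rank = k := by
    refine le_antisymm ?_ ?_
    · rw [← h4]
      exact (Matrix.rank_mul_le_left _ _).trans (rank_idBlock hk).le
    · rw [← rank_idBlock hk, ← h3]
      exact Matrix.rank_mul_le_left _ _
  have hS : S.rank = k := by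
    rw [← hR]
    refine le_antisymm ?_ ?_
    · rw [h.S_eq]
      exact (Matrix.rank_mul_le_left _ _).trans (Matrix.rank_mul_le_right _ _)
    · rw [h.R_eq]
      exact (Matrix.rank_mul_le_right _ _).trans (Matrix.rank_mul_le_left _ _)
  rw [hS]
  exact ⟨h1, h2⟩

lemma IsQRCP.isUnit_det_leadingBlock (h : IsQRCP S π Q R) {k : ℕ} (hk : k ≤ s)
    (hkr : k ≤ S.rank) : IsUnit (leadingBlock hk R).det := by
  rw [det_leadingBlock h.upper, isUnit_iff_ne_zero, Finset.prod_ne_zero_iff]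
  exact fun i _ => h.of_rank.1 _ (by simpa using i.2.trans_le hkr)

lemma IsQRCP.le_rank (h : IsQRCP S π Q R) {k : ℕ} (hk : k ≤ s)
    (hdet : IsUnit (leadingBlock hk R).det) : k ≤ S.rank := by
  by_contra! hlt
  rw [det_leadingBlock h.upper, isUnit_iff_ne_zero, Finset.prod_ne_zero_iff] at hdet
  exact hdet ⟨S.rank, hlt⟩ (Finset.mem_univ _) (h.of_rank.2 _ _ le_rfl)

lemma IsQRCP.smul (h : IsQRCP S π Q R) {c : ℝ} (hc : 0 < c) : IsQRCP (c • S) π Q (c • R) where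
  eq := by rw [Matrix.smul_mul, h.eq, Matrix.mul_smul]
  orth := h.orth
  upper i j hij := by rw [Matrix.smul_apply, h.upper i j hij, smul_zero]
  diag_nonneg i := mul_nonneg hc.le (h.diag_nonneg i)
  pivoting i j hij := by
    simp only [Matrix.smul_apply, smul_eq_mul, mul_pow, ← Finset.mul_sum]
    exact mul_le_mul_of_nonneg_left (h.pivoting i j hij) (sq_nonneg c)

/-- Pivoted QR factorizations of convergent matrices converge along an ultrafilter, since the
orthogonal factors are bounded. -/
lemma IsQRCP.exists_limit {ι : Type*} (u : Ultrafilter ι) {S Q R : ι → Matrix (Fin s) (Fin s) ℝ}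
    {S₀ : Matrix (Fin s) (Fin s) ℝ} (hS : Tendsto S u (𝓝 S₀))
    (h : ∀ᶠ i in (u : Filter ι), IsQRCP (S i) π (Q i) (R i)) :
    ∃ Q₀ R₀, IsQRCP S₀ π Q₀ R₀ ∧ Tendsto Q u (𝓝 Q₀) ∧ Tendsto R u (𝓝 R₀) := by
  obtain ⟨Q₀, hQ⟩ : ∃ Q₀, Tendsto Q u (𝓝 Q₀) := by
    refine exists_tendsto_matrix fun a b => u.exists_tendsto_of_abs_le (C := 1) ?_
    filter_upwards [h] with i hi
    have h1 := congrFun (congrFun hi.orth b) b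
    rw [Matrix.mul_apply, Matrix.one_apply_eq] at h1
    have h2 := Finset.single_le_sum (f := fun t => (Q i)ᵀ b t * Q i t b)
      (fun t _ => mul_self_nonneg (Q i t b)) (Finset.mem_univ a)
    rw [h1] at h2
    exact abs_le_one_iff_mul_self_le_one.2 h2
  have hQt : Tendsto (fun i => (Q i)ᵀ) u (𝓝 Q₀ᵀ) :=
    (continuous_id.matrix_transpose.tendsto Q₀).comp hQ
  have hSP : Tendsto (fun i => S i * π.permMatrix ℝ) u (𝓝 (S₀ * π.permMatrix ℝ)) :=
    hS.mul tendsto_const_nhds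
  have hR : Tendsto R u (𝓝 (Q₀ᵀ * (S₀ * π.permMatrix ℝ))) :=
    (hQt.mul hSP).congr' (h.mono fun i hi => hi.R_eq.symm)
  have hR' := fun a b => tendsto_matrix_iff.1 hR a b
  refine ⟨Q₀, _, ⟨?_, ?_, ?_, ?_, ?_⟩, hQ, hR⟩
  · exact tendsto_nhds_unique_of_eventuallyEq hSP (hQ.mul hR) (h.mono fun i hi => hi.eq)
  · exact tendsto_nhds_unique_of_eventuallyEq (hQt.mul hQ) tendsto_const_nhds
      (h.mono fun i hi => hi.orth)
  · exact fun i j hij => tendsto_nhds_unique_of_eventuallyEq (hR' i j) tendsto_const_nhds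
      (h.mono fun m hm => hm.upper i j hij)
  · exact fun i => ge_of_tendsto (hR' i i) (h.mono fun m hm => hm.diag_nonneg i)
  · exact fun i j hij => le_of_tendsto_of_tendsto
      (tendsto_finsetSum _ fun t _ => (hR' t j).pow 2) ((hR' i i).pow 2)
      (h.mono fun m hm => hm.pivoting i j hij)

end QR

/-! ### The hybrid operator of an exact factorization -/

section Exact

variable {n : ℕ} {A : Matrix (Fin n) (Fin n) ℝ} {F : MLILU n} {K : ℝ}

lemma MLILU.IsFactorization.core_eq {δ : ℝ} (h : F.IsFactorization A δ) :
    F.core = blockDiag F.d_le (Matrix.diagonal F.pivots) F.schur := by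
  have h0 := ILUChain.off_diag h (fun i j _ hij => by omega)
  ext i j
  obtain ⟨i, rfl⟩ := (splitEquiv F.d_le).surjective i
  obtain ⟨j, rfl⟩ := (splitEquiv F.d_le).surjective j
  rcases i with i | i <;> rcases j with j | j
  · by_cases hij : i = j
    · subst hij
      simp [blockDiag, MLILU.pivots, ← splitEquiv_inl F.d_le]
    · rw [h0 _ _ (by simpa using hij) (Or.inl (by simp))]
      simp [blockDiag, Matrix.diagonal_apply_ne _ hij]
  · rw [h0 _ _ (by simp) (Or.inl (by simp))]
    simp [blockDiag]
  · rw [h0 _ _ (by simp) (Or.inr (by simp))]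
    simp [blockDiag]
  · simp [blockDiag, MLILU.schur]

/-- The hybrid operator of a factorization without dropping, truncated at the exact rank, is a
generalized inverse of `A`. Here `X = L diag(I, Q)`. -/
lemma exact_hifOperator (hF : F.IsFactorization A 0) (hK : F.WellConditioned K)
    {π : Equiv.Perm (Fin (n - F.d))} {Q R : Matrix (Fin (n - F.d)) (Fin (n - F.d)) ℝ}
    (hqr : IsQRCP F.schur π Q R) (hk : F.schur.rank ≤ n - F.d) :
    ∃ X : Matrix (Fin n) (Fin n) ℝ, IsUnit X.det ∧
      A * hifOperator F π Q R hk * A = A ∧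
      A * hifOperator F π Q R hk = X * idBlock n (F.d + F.schur.rank) * X⁻¹ ∧
      A.rank = F.d + F.schur.rank := by
  have hL : IsUnit (leftProd F.levels).det := isUnit_det_leftProd _ hK.1
  have hU : IsUnit (rightProd F.levels).det := isUnit_det_rightProd _ hK.1
  have hA : A = leftProd F.levels * F.core * rightProd F.levels :=
    ILUChain.eq_mul hF (fun i j _ hij => by omega)
  have hQQ := hqr.orth'
  set Y := blockDiag F.d_le 1 Q with hY
  have hYY : Y * Yᵀ = 1 := by
    rw [hY, blockDiag_transpose, blockDiag_mul, hQQ, Matrix.transpose_one, Matrix.one_mul,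
      blockDiag_one_one]
  have hRp := mul_paddedInv hk (hqr.isUnit_det_leadingBlock hk le_rfl) hqr.of_rank.2
  set M := blockDiag F.d_le (Matrix.diagonal F.pivots)⁻¹
    (π.permMatrix ℝ * paddedInv hk R * Qᵀ) with hM
  have hcM : F.core * M = Y * idBlock n (F.d + F.schur.rank) * Yᵀ := by
    rw [hF.core_eq, hM, blockDiag_mul, Matrix.mul_nonsing_inv _ hK.2.1, hY, blockDiag_transpose,
      ← blockDiag_one_idBlock F.d_le, blockDiag_mul, blockDiag_mul, Matrix.transpose_one,
      Matrix.one_mul, Matrix.one_mul, ← hRp]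
    congr 1
    rw [← Matrix.mul_assoc Q, ← hqr.eq]
    simp only [Matrix.mul_assoc]
  have hcore : F.core * M * F.core = F.core := by
    rw [hF.core_eq, hM, blockDiag_mul, blockDiag_mul, Matrix.mul_nonsing_inv _ hK.2.1,
      Matrix.one_mul]
    congr 1
    have h1 : idBlock (n - F.d) F.schur.rank * R = R := by
      ext i j
      rw [idBlock_mul_apply]
      split_ifs with hi
      · rfl
      · rw [hqr.of_rank.2 i j (not_lt.1 hi)]
    calc F.schur * (π.permMatrix ℝ * paddedInv hk R * Qᵀ) * F.schur
        = (F.schur * π.permMatrix ℝ) * paddedInv hk R * (Qᵀ * F.schur) := by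
          simp only [Matrix.mul_assoc]
      _ = Q * (R * paddedInv hk R) * (Qᵀ * (Q * R * (π.permMatrix ℝ)ᵀ)) := by
          rw [hqr.eq, ← hqr.S_eq]
          simp only [Matrix.mul_assoc]
      _ = Q * (idBlock (n - F.d) F.schur.rank * R) * (π.permMatrix ℝ)ᵀ := by
          rw [hRp, ← Matrix.mul_assoc Qᵀ, ← Matrix.mul_assoc Qᵀ, hqr.orth, Matrix.one_mul]
          simp only [Matrix.mul_assoc]
      _ = F.schur := by rw [h1, ← hqr.S_eq]
  have hAG : A * hifOperator F π Q R hk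
      = leftProd F.levels * (F.core * M) * (leftProd F.levels)⁻¹ := by
    conv_lhs => rw [hA]
    rw [hifOperator, ← hM]
    simp only [Matrix.mul_assoc]
    rw [Matrix.mul_nonsing_inv_cancel_left _ _ hU]
  have hXinv : (leftProd F.levels * Y)⁻¹ = Yᵀ * (leftProd F.levels)⁻¹ := by
    rw [Matrix.mul_inv_rev, Matrix.inv_eq_right_inv hYY]
  have hAGX : A * hifOperator F π Q R hk
      = leftProd F.levels * Y * idBlock n (F.d + F.schur.rank) * (leftProd F.levels * Y)⁻¹ := by
    rw [hAG, hcM, hXinv]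
    simp only [Matrix.mul_assoc]
  have hAGA : A * hifOperator F π Q R hk * A = A := by
    rw [hAG]
    conv_lhs => rw [hA]
    conv_rhs => rw [hA, ← hcore]
    simp only [Matrix.mul_assoc]
    rw [Matrix.nonsing_inv_mul_cancel_left _ _ hL]
  have hX : IsUnit (leftProd F.levels * Y).det := by
    rw [Matrix.det_mul]
    refine hL.mul ?_
    rw [← Matrix.isUnit_iff_isUnit_det]
    exact IsUnit.of_mul_eq_one _ hYY
  refine ⟨leftProd F.levels * Y, hX, hAGA, hAGX, ?_⟩
  have hle : F.d + F.schur.rank ≤ n := by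
    have := F.d_le
    omega
  have h1 : (A * hifOperator F π Q R hk).rank = F.d + F.schur.rank := by
    rw [hAGX, Matrix.rank_mul_eq_left_of_isUnit_det _ _ (Matrix.isUnit_nonsing_inv_det _ hX),
      Matrix.rank_mul_eq_right_of_isUnit_det _ _ hX, rank_idBlock hle]
  rw [← h1]
  refine le_antisymm ?_ (Matrix.rank_mul_le_left _ _)
  conv_lhs => rw [← hAGA]
  exact Matrix.rank_mul_le_left _ _

end Exact

/-! ### Convergence of GMRES -/

/-- An accurate approximate generalized inverse makes `A G` injective on the range of `A`: in the
coordinates given by `X`, the range of `A` is fixed by `diag(I_r, 0)`, and `A G` is at distance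
less than `1` from it. -/
lemma IsAccurateAGI.eq_zero_of_mulVec_eq_zero {n : ℕ} {A G : Matrix (Fin n) (Fin n) ℝ} {ε : ℝ}
    (h : IsAccurateAGI A G ε) {v : Fin n → ℝ} (hv : v ∈ LinearMap.range A.mulVecLin)
    (h0 : (A * G) *ᵥ v = 0) : v = 0 := by
  obtain ⟨X, hX, ⟨Ag, h1, h2⟩, h3, h4⟩ := h
  obtain ⟨z, rfl⟩ := hv
  simp only [Matrix.mulVecLin_apply] at h0 ⊢
  set v := A *ᵥ z with hv
  have h5 : (X * idBlock n A.rank * X⁻¹) *ᵥ v = v := by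
    rw [← h2, hv, Matrix.mulVec_mulVec, h1]
  set u := X⁻¹ *ᵥ v with hu
  have hXu : X *ᵥ u = v := by
    rw [hu, Matrix.mulVec_mulVec, Matrix.mul_nonsing_inv _ hX, Matrix.one_mulVec]
  have h6 : idBlock n A.rank *ᵥ u = u := by
    have h6 := congrArg (X⁻¹ *ᵥ ·) h5
    rwa [Matrix.mul_assoc, ← Matrix.mulVec_mulVec, ← Matrix.mulVec_mulVec,
      Matrix.mulVec_mulVec _ X⁻¹ X, Matrix.nonsing_inv_mul _ hX, Matrix.one_mulVec, ← hu] at h6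
  have h7 : (X⁻¹ * A * G * X - idBlock n A.rank) *ᵥ u = -u := by
    rw [Matrix.sub_mulVec, h6, ← Matrix.mulVec_mulVec, hXu, Matrix.mul_assoc X⁻¹ A G,
      ← Matrix.mulVec_mulVec, h0, Matrix.mulVec_zero, zero_sub]
  have h8 := Matrix.l2_opNorm_mulVec (X⁻¹ * A * G * X - idBlock n A.rank) (WithLp.toLp 2 u)
  simp only [h7, h3] at h8
  have h9 : ‖WithLp.toLp 2 u‖ ≤ 0 := by
    change ‖-WithLp.toLp 2 u‖ ≤ ε * ‖WithLp.toLp 2 u‖ at h8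
    rw [norm_neg] at h8
    nlinarith [norm_nonneg (WithLp.toLp 2 u)]
  have hu0 : u = 0 := by simpa using norm_le_zero_iff.1 h9
  rw [← hXu, hu0, Matrix.mulVec_zero]

lemma krylov_le_range {n : ℕ} {A G : Matrix (Fin n) (Fin n) ℝ} {r : Fin n → ℝ}
    (hr : r ∈ LinearMap.range A.mulVecLin) (k : ℕ) :
    krylov (A * G) r k ≤ LinearMap.range A.mulVecLin := by
  refine Submodule.span_le.2 ?_
  rintro _ ⟨i, rfl⟩
  obtain ⟨i, hi⟩ := i
  cases i with
  | zero => simpa [krylovVec] using hr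
  | succ i =>
    refine ⟨G *ᵥ ((A * G) ^ i *ᵥ r), ?_⟩
    simp [krylovVec, pow_succ', Matrix.mul_assoc]

/-- If `A G` is injective on the range of `A`, then GMRES terminates with an exact solution at the
grade of the initial residual, where the Krylov subspace becomes invariant under `A G`. -/
lemma gmresFindsLS_of_injOn {n : ℕ} {A G : Matrix (Fin n) (Fin n) ℝ}
    (h : ∀ v ∈ LinearMap.range A.mulVecLin, (A * G) *ᵥ v = 0 → v = 0) {b : Fin n → ℝ}
    (hb : b ∈ Set.range A.mulVec) (x₀ : Fin n → ℝ) : GMRESFindsLS A G b x₀ := by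
  set B := A * G with hB
  set r := b - A *ᵥ x₀ with hrdef
  have hr : r ∈ LinearMap.range A.mulVecLin := by
    obtain ⟨z, rfl⟩ := hb
    exact ⟨z - x₀, by simp [hrdef, Matrix.mulVec_sub]⟩
  have hex : ∃ k, ¬ LinearIndependent ℝ (krylovVec B r (k + 1)) := by
    refine ⟨n, fun hli => ?_⟩
    have := hli.fintype_card_le_finrank
    simp at this
  classical
  set k := Nat.find hex with hk
  have hdep : ¬ LinearIndependent ℝ (krylovVec B r (k + 1)) := Nat.find_spec hex
  have hind : LinearIndependent ℝ (krylovVec B r k) := by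
    rcases Nat.eq_zero_or_pos k with h0 | h0
    · rw [h0]
      exact linearIndependent_empty_type
    · have := Nat.find_min hex (m := k - 1) (by omega)
      rwa [not_not, Nat.sub_add_cancel h0] at this
  have hlast : (B ^ k) *ᵥ r ∈ krylov B r k := by
    by_contra hnot
    refine hdep (linearIndependent_finSucc'.2 ⟨hind, ?_⟩)
    exact hnot
  have hdisj : ∀ j, Disjoint (krylov B r j) (LinearMap.ker B.mulVecLin) := fun j =>
    Submodule.disjoint_def.2 fun v hv hv0 => h v (krylov_le_range hr j hv) (by simpa using hv0)
  -- at the grade `k`, the Krylov subspace is invariant under `B`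
  have hinv : ∀ v ∈ krylov B r k, B.mulVecLin v ∈ krylov B r k := by
    intro v hv
    have hle : krylov B r k ≤ (krylov B r k).comap B.mulVecLin := by
      refine Submodule.span_le.2 ?_
      rintro _ ⟨i, rfl⟩
      have hi : B *ᵥ krylovVec B r k i = (B ^ (i.val + 1)) *ᵥ r := by
        simp [krylovVec, pow_succ']
      simp only [Submodule.comap_coe, Set.mem_preimage, Matrix.mulVecLin_apply, SetLike.mem_coe, hi]
      rcases (Nat.succ_le_of_lt i.2).lt_or_eq with hlt | heq
      · exact Submodule.subset_span ⟨⟨i.val + 1, hlt⟩, rfl⟩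
      · rwa [← Nat.succ_eq_add_one, heq]
    exact hle hv
  have hr_mem : r ∈ krylov B r k := by
    rcases Nat.eq_zero_or_pos k with h0 | h0
    · rw [h0] at hlast ⊢
      simpa using hlast
    · exact Submodule.subset_span ⟨⟨0, h0⟩, by simp [krylovVec]⟩
  -- being injective there, `B` maps it onto itself, and it attains `r`
  have hsurj : Function.Surjective (B.mulVecLin.restrict hinv) := by
    refine LinearMap.injective_iff_surjective.1 ((injective_iff_map_eq_zero _).2 fun v hv => ?_)
    have hv' : B *ᵥ v.1 = 0 := by simpa using congrArg Subtype.val hv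
    exact Subtype.ext (h v.1 (krylov_le_range hr k v.2) hv')
  obtain ⟨⟨y, hy⟩, hy'⟩ := hsurj ⟨r, hr_mem⟩
  have hBy : B *ᵥ y = r := by simpa using congrArg Subtype.val hy'
  have hres : ∀ z, b - A *ᵥ (x₀ + G *ᵥ z) = r - B *ᵥ z := fun z => by
    rw [Matrix.mulVec_add, Matrix.mulVec_mulVec, hrdef, sub_sub]
  have hzero : residualNorm A b (x₀ + G *ᵥ y) = 0 := by
    simp [residualNorm, hres, hBy]
  have hmin : ∀ z, residualNorm A b (x₀ + G *ᵥ y) ≤ residualNorm A b z := fun z => by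
    rw [hzero]
    exact norm_nonneg _
  refine ⟨k, fun j hj => ?_, x₀ + G *ᵥ y, ⟨y, hy, rfl, fun z _ => hmin _⟩, hmin, ?_⟩
  · have hj' : LinearIndependent ℝ (krylovVec B r j) :=
      hind.comp (Fin.castLE hj) (Fin.castLE_injective hj)
    exact ⟨hj', hj'.map (f := B.mulVecLin) (hdisj j)⟩
  · rintro _ ⟨y', hy', rfl, hle⟩
    have h1 : residualNorm A b (x₀ + G *ᵥ y') ≤ 0 := hzero ▸ hle y hy
    have h2 : r - B *ᵥ y' = 0 := by
      have := norm_le_zero_iff.1 h1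
      rw [hres] at this
      exact (WithLp.toLp_eq_zero 2).1 this
    have h3 : y' - y = 0 := by
      refine h _ (Submodule.sub_mem _ (krylov_le_range hr k hy') (krylov_le_range hr k hy)) ?_
      rw [Matrix.mulVec_sub, hBy, ← sub_eq_zero.1 h2, sub_self]
    rw [sub_eq_zero.1 h3]

/-! ### Normalization -/

section Normalize

variable {n : ℕ}

lemma ILUChain.exists_w_v_eq_one {δ : ℝ} {o d : ℕ} {T T' : Matrix (Fin n) (Fin n) ℝ}
    {ls : List (ILULevel n)} (h : ILUChain δ o T ls d T') (ho : 0 < o) :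
    ∀ l ∈ ls, (∃ a, l.w a = 1) ∧ ∃ a, l.v a = 1 := by
  induction h with
  | nil => simp
  | cons step _ ih =>
    intro l hl
    rcases List.mem_cons.1 hl with rfl | hl
    · have hn : 0 < n := by have := step.lt; have := step.le; omega
      exact ⟨⟨⟨0, hn⟩, step.w_one _ ho⟩, ⟨⟨0, hn⟩, step.v_one _ ho⟩⟩
    · exact ih (ho.trans step.lt) l hl

/-- The row and column scalings of the first level may be multiplied by arbitrary positive
factors. This multiplies all pivots and Schur complements by a constant, and allows for
normalizing the scalings. -/
lemma ILUChain.exists_normalized {δ K : ℝ} {d : ℕ} {A T : Matrix (Fin n) (Fin n) ℝ}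
    {ls : List (ILULevel n)} (h : ILUChain δ 0 A ls d T)
    (hK : ∀ l ∈ ls, CondLE l.L K ∧ CondLE l.U K ∧ CondLE l.W K ∧ CondLE l.V K) :
    ∃ (ls' : List (ILULevel n)) (a b : ℝ), 0 < a ∧ 0 < b ∧ ILUChain δ 0 A ls' d ((a * b) • T) ∧
      (∀ l ∈ ls', l.IsNormalized K) ∧ leftProd ls' = a⁻¹ • leftProd ls ∧
      rightProd ls' = b⁻¹ • rightProd ls := by
  rcases h.eq_nil_or_exists_cons with ⟨rfl, rfl, rfl⟩ | ⟨l, m, o', T', rfl, hstep, hrest⟩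
  · exact ⟨[], 1, 1, one_pos, one_pos, by simpa using ILUChain.nil 0 T, by simp, by simp, by simp⟩
  have hn : 0 < n := by have := hstep.lt; have := hstep.le; omega
  set i₀ : Fin n := ⟨0, hn⟩
  set a := (l.w i₀)⁻¹ with ha
  set b := (l.v i₀)⁻¹ with hb
  have ha0 : 0 < a := inv_pos.2 (hstep.w_pos i₀)
  have hb0 : 0 < b := inv_pos.2 (hstep.v_pos i₀)
  set l' : ILULevel n := { l with w := a • l.w, v := b • l.v } with hl'
  have hW : l'.W = a • l.W := by simp only [ILULevel.W, hl', Matrix.diagonal_smul]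
  have hV : l'.V = b • l.V := by simp only [ILULevel.V, hl', Matrix.diagonal_smul]
  have hstep' : ILUStep δ 0 A l' o' ((a * b) • T') := by
    refine hstep.rescale (mul_pos ha0 hb0).ne' rfl rfl rfl rfl
      (fun i => mul_pos ha0 (hstep.w_pos i)) (fun i => mul_pos hb0 (hstep.v_pos i))
      (fun i hi => absurd hi (by omega)) (fun i hi => absurd hi (by omega)) ?_
      (fun i hi => absurd hi (by omega))
    ext i j
    rw [Matrix.smul_apply, ILULevel.prep_apply, ILULevel.prep_apply]
    simp only [hl', Pi.smul_apply, smul_eq_mul]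
    ring
  refine ⟨l' :: m, a, b, ha0, hb0, .cons hstep' (hrest.smul (mul_pos ha0 hb0).ne'), ?_, ?_, ?_⟩
  · intro x hx
    rcases List.mem_cons.1 hx with rfl | hx
    · have h1 := hK l (by simp)
      refine ⟨⟨h1.1, h1.2.1, ?_, ?_⟩, ⟨i₀, ?_⟩, ⟨i₀, ?_⟩⟩
      · rw [hW, condLE_smul_iff _ ha0.ne']
        exact h1.2.2.1
      · rw [hV, condLE_smul_iff _ hb0.ne']
        exact h1.2.2.2
      · exact inv_mul_cancel₀ (hstep.w_pos i₀).ne'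
      · exact inv_mul_cancel₀ (hstep.v_pos i₀).ne'
    · exact ⟨hK x (List.mem_cons_of_mem _ hx), hrest.exists_w_v_eq_one hstep.lt x hx⟩
  · simp only [leftProd]
    rw [hW, inv_smul_of_ne_zero _ ha0.ne']
    simp only [Matrix.smul_mul]
    rfl
  · simp only [rightProd]
    rw [hV, inv_smul_of_ne_zero _ hb0.ne']
    simp only [Matrix.mul_smul]
    rfl

/-- `F` is a multilevel factorization of `A` with droppings at most `δ`, normalized levels and
well conditioned pivots, and `Q R` is a pivoted QR factorization of its final Schur complement. -/
structure MLILU.IsNormalizedQR (F : MLILU n) (A : Matrix (Fin n) (Fin n) ℝ) (δ K : ℝ)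
    (π : Equiv.Perm (Fin (n - F.d))) (Q R : Matrix (Fin (n - F.d)) (Fin (n - F.d)) ℝ) : Prop where
  fact : F.IsFactorization A δ
  norm : ∀ l ∈ F.levels, l.IsNormalized K
  cond : CondLE (Matrix.diagonal F.pivots) K
  qr : IsQRCP F.schur π Q R

lemma MLILU.exists_isNormalizedQR {d : ℕ} {hd : d ≤ n} {ls : List (ILULevel n)}
    {core A : Matrix (Fin n) (Fin n) ℝ} {δ K : ℝ} {π : Equiv.Perm (Fin (n - d))}
    {Q R : Matrix (Fin (n - d)) (Fin (n - d)) ℝ}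
    (hF : (MLILU.mk ls d hd core).IsFactorization A δ)
    (hK : (MLILU.mk ls d hd core).WellConditioned K)
    (hqr : IsQRCP (MLILU.mk ls d hd core).schur π Q R) :
    ∃ (ls' : List (ILULevel n)) (core' : Matrix (Fin n) (Fin n) ℝ)
      (R' : Matrix (Fin (n - d)) (Fin (n - d)) ℝ) (c : ℝ), c ≠ 0 ∧
      (MLILU.mk ls' d hd core').IsNormalizedQR A δ K π Q R' ∧
      (∀ k (hk : k ≤ n - d),
        (MLILU.mk ls' d hd core').middle hk R' = c • (MLILU.mk ls d hd core).middle hk R) ∧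
      ∀ k (hk : k ≤ n - d), hifOperator (MLILU.mk ls' d hd core') π Q R' hk
        = hifOperator (MLILU.mk ls d hd core) π Q R hk := by
  obtain ⟨ls', a, b, ha, hb, h1, h2, h3, h4⟩ := ILUChain.exists_normalized hF hK.1
  have hc : 0 < a * b := mul_pos ha hb
  have hpiv : Matrix.diagonal (MLILU.mk ls' d hd ((a * b) • core)).pivots
      = (a * b) • Matrix.diagonal (MLILU.mk ls d hd core).pivots := by
    rw [← Matrix.diagonal_smul]
    rfl
  have hlead : ∀ k (hk : k ≤ n - d), leadingBlock hk ((a * b) • R) = (a * b) • leadingBlock hk R :=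
    fun k hk => rfl
  refine ⟨ls', (a * b) • core, (a * b) • R, a * b, hc.ne', ⟨h1, h2, ?_, hqr.smul hc⟩, ?_, ?_⟩
  · rw [hpiv, condLE_smul_iff _ hc.ne']
    exact hK.2
  · intro k hk
    simp only [MLILU.middle]
    rw [hlead, hpiv, Matrix.fromBlocks_smul]
    simp
  · intro k hk
    have hpad : paddedInv hk ((a * b) • R) = (a * b)⁻¹ • paddedInv hk R := by
      rw [paddedInv, paddedInv, hlead, inv_smul_of_ne_zero _ hc.ne', ← blockDiag_smul, smul_zero]
    simp only [hifOperator]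
    rw [hpiv, hpad, h3, h4, inv_smul_of_ne_zero _ hc.ne',
      inv_smul_of_ne_zero _ (inv_ne_zero ha.ne'), inv_smul_of_ne_zero _ (inv_ne_zero hb.ne')]
    simp only [Matrix.mul_smul, Matrix.smul_mul, blockDiag_smul, inv_inv, smul_smul]
    rw [show a * ((a * b)⁻¹ * b) = 1 by field_simp, one_smul]

/-- The pivots of the normalized factorizations of `A` are bounded away from `0` and infinity: the
first pivot is a nonzero entry of `A` up to scaling, and the others are comparable to it. -/
lemma MLILU.exists_pivot_bounds (A : Matrix (Fin n) (Fin n) ℝ) (K : ℝ) :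
    ∃ c B : ℝ, 0 < c ∧ ∀ (F : MLILU n) (δ : ℝ), F.IsFactorization A δ →
      (∀ l ∈ F.levels, l.IsNormalized K) → CondLE (Matrix.diagonal F.pivots) K →
      ∀ k : Fin n, k.val < F.d → c ≤ |F.core k k| ∧ |F.core k k| ≤ B := by
  obtain ⟨m, hm, hm'⟩ : ∃ m > 0, ∀ i j, A i j ≠ 0 → m ≤ |A i j| := by
    rcases isEmpty_or_nonempty (Fin n × Fin n) with he | he
    · exact ⟨1, one_pos, fun i j => (he.false (i, j)).elim⟩
    · obtain ⟨x, hx⟩ := Finite.exists_min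
        fun x : Fin n × Fin n => if A x.1 x.2 = 0 then 1 else |A x.1 x.2|
      refine ⟨if A x.1 x.2 = 0 then 1 else |A x.1 x.2|, ?_, fun i j hij => ?_⟩
      · split_ifs with h
        · exact one_pos
        · exact abs_pos.2 h
      · simpa [hij] using hx (i, j)
  refine ⟨m / (|K| ^ 3 + 1), K ^ 3 * ‖A‖, by positivity, ?_⟩
  intro F δ hF hnorm hcond k hk
  rcases ILUChain.eq_nil_or_exists_cons hF with ⟨-, h0, -⟩ | ⟨l, ms, o', T', hl, hstep, hrest⟩
  · omega
  have hn : 0 < n := by have := k.2; omega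
  set i₀ : Fin n := ⟨0, hn⟩
  have h1 : F.core i₀ i₀ = l.prep A i₀ i₀ := by
    rw [hrest.pivot_eq i₀ hstep.lt, hstep.pivot i₀ le_rfl hstep.lt]
    simp [ILULevel.update, i₀]
  have h2 : F.core i₀ i₀ ≠ 0 := by
    rw [hrest.pivot_eq i₀ hstep.lt]
    exact hstep.pivot_ne i₀ le_rfl hstep.lt
  have hl' := hnorm l (by rw [hl]; simp)
  rw [ILULevel.prep_apply] at h1
  set α := A (l.p.symm i₀) (l.q.symm i₀) with hα
  obtain ⟨hw1, hw2⟩ := abs_bounds_of_condLE_diagonal hl'.1.2.2.1 hl'.2.1 (l.p.symm i₀)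
  obtain ⟨hv1, hv2⟩ := abs_bounds_of_condLE_diagonal hl'.1.2.2.2 hl'.2.2 (l.q.symm i₀)
  have hα0 : α ≠ 0 := by
    intro h0
    rw [h0] at h1
    exact h2 (by rw [h1]; ring)
  have hαm : m ≤ |α| := hm' _ _ hα0
  have hαM : |α| ≤ ‖A‖ := abs_apply_le_norm _ _ _
  have hK : 0 < K := by
    by_contra! hK
    nlinarith [abs_nonneg (l.w (l.p.symm i₀))]
  have hp : |F.core i₀ i₀| = |l.w (l.p.symm i₀)| * |α| * |l.v (l.q.symm i₀)| := by
    rw [h1, abs_mul, abs_mul]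
  have h3 := hcond.diagonal_abs_le ⟨k, hk⟩ ⟨0, by omega⟩
  have h4 := hcond.diagonal_abs_le ⟨0, by omega⟩ ⟨k, hk⟩
  change |F.core k k| ≤ K * |F.core i₀ i₀| at h3
  change |F.core i₀ i₀| ≤ K * |F.core k k| at h4
  have h5 : |F.core i₀ i₀| ≤ K * ‖A‖ * K := by
    rw [hp]
    gcongr
  have h6 : m ≤ K ^ 2 * |F.core i₀ i₀| := by
    calc m ≤ 1 * |α| * 1 := by linarith
      _ ≤ (K * |l.w (l.p.symm i₀)|) * |α| * (K * |l.v (l.q.symm i₀)|) := by gcongr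
      _ = _ := by rw [hp]; ring
  constructor
  · rw [div_le_iff₀ (by positivity), abs_of_pos hK]
    calc m ≤ K ^ 2 * (K * |F.core k k|) := h6.trans (by gcongr)
      _ ≤ |F.core k k| * (K ^ 3 + 1) := by nlinarith [abs_nonneg (F.core k k)]
  · calc |F.core k k| ≤ K * (K * ‖A‖ * K) := h3.trans (by gcongr)
      _ = K ^ 3 * ‖A‖ := by ring

end Normalize

/-! ### Limits of hybrid factorizations -/

section HIFLimits

variable {ι : Type*} {n d : ℕ} (hd : d ≤ n) {A : Matrix (Fin n) (Fin n) ℝ} {K : ℝ}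
  {ls : ι → List (ILULevel n)} {core : ι → Matrix (Fin n) (Fin n) ℝ}
  {π : Equiv.Perm (Fin (n - d))} {Q R : ι → Matrix (Fin (n - d)) (Fin (n - d)) ℝ}

lemma tendsto_pivots {F : Filter ι} {core₀ : Matrix (Fin n) (Fin n) ℝ}
    {ls₀ : List (ILULevel n)} (h : Tendsto core F (𝓝 core₀)) :
    Tendsto (fun i => Matrix.diagonal (MLILU.mk (ls i) d hd (core i)).pivots) F
      (𝓝 (Matrix.diagonal (MLILU.mk ls₀ d hd core₀).pivots)) := by
  have hc : Continuous fun M : Matrix (Fin n) (Fin n) ℝ =>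
      Matrix.diagonal fun i => M (Fin.castLE hd i) (Fin.castLE hd i) :=
    (continuous_pi fun i => continuous_id.matrix_elem _ _).matrix_diagonal
  exact (hc.tendsto core₀).comp h

lemma tendsto_schur {F : Filter ι} {core₀ : Matrix (Fin n) (Fin n) ℝ}
    {ls₀ : List (ILULevel n)} (h : Tendsto core F (𝓝 core₀)) :
    Tendsto (fun i => (MLILU.mk (ls i) d hd (core i)).schur) F
      (𝓝 (MLILU.mk ls₀ d hd core₀).schur) :=
  ((continuous_id.matrix_submatrix (A := fun M : Matrix (Fin n) (Fin n) ℝ => M) _ _).tendsto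
    core₀).comp h

lemma tendsto_leadingBlock {F : Filter ι} {R₀ : Matrix (Fin (n - d)) (Fin (n - d)) ℝ}
    (h : Tendsto R F (𝓝 R₀)) {k : ℕ} (hk : k ≤ n - d) :
    Tendsto (fun i => leadingBlock hk (R i)) F (𝓝 (leadingBlock hk R₀)) :=
  ((continuous_id.matrix_submatrix
    (A := fun M : Matrix (Fin (n - d)) (Fin (n - d)) ℝ => M) _ _).tendsto R₀).comp h

lemma tendsto_middle {F : Filter ι} {core₀ : Matrix (Fin n) (Fin n) ℝ}
    {ls₀ : List (ILULevel n)} {R₀ : Matrix (Fin (n - d)) (Fin (n - d)) ℝ}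
    (h : Tendsto core F (𝓝 core₀)) (hR : Tendsto R F (𝓝 R₀)) {k : ℕ} (hk : k ≤ n - d) :
    Tendsto (fun i => (MLILU.mk (ls i) d hd (core i)).middle hk (R i)) F
      (𝓝 ((MLILU.mk ls₀ d hd core₀).middle hk R₀)) := by
  have hc : Continuous fun p : Matrix (Fin d) (Fin d) ℝ × Matrix (Fin k) (Fin k) ℝ =>
      Matrix.fromBlocks p.1 0 0 p.2 :=
    continuous_fst.matrix_fromBlocks continuous_const continuous_const continuous_snd
  exact (hc.tendsto (_, _)).comp
    ((tendsto_pivots hd h).prodMk_nhds (tendsto_leadingBlock hR hk))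

/-- Normalized hybrid factorizations whose droppings tend to `0` converge, along an ultrafilter,
to a factorization without dropping. -/
lemma MLILU.IsNormalizedQR.exists_limit (u : Ultrafilter ι) {δ : ι → ℝ} (hδ : Tendsto δ u (𝓝 0))
    (h : ∀ᶠ i in (u : Filter ι),
      (MLILU.mk (ls i) d hd (core i)).IsNormalizedQR A (δ i) K π (Q i) (R i)) :
    ∃ (ls₀ : List (ILULevel n)) (core₀ : Matrix (Fin n) (Fin n) ℝ)
      (Q₀ R₀ : Matrix (Fin (n - d)) (Fin (n - d)) ℝ),
      (MLILU.mk ls₀ d hd core₀).IsFactorization A 0 ∧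
      (MLILU.mk ls₀ d hd core₀).WellConditioned K ∧
      IsQRCP (MLILU.mk ls₀ d hd core₀).schur π Q₀ R₀ ∧
      Tendsto core u (𝓝 core₀) ∧ Tendsto Q u (𝓝 Q₀) ∧ Tendsto R u (𝓝 R₀) ∧
      Tendsto (fun i => leftProd (ls i)) u (𝓝 (leftProd ls₀)) ∧
      Tendsto (fun i => rightProd (ls i)) u (𝓝 (rightProd ls₀)) := by
  obtain ⟨c, B, hc, hcB⟩ := MLILU.exists_pivot_bounds A K
  have hp : ∀ᶠ i in (u : Filter ι), ∀ k : Fin n, k.val < d →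
      c ≤ |core i k k| ∧ |core i k k| ≤ B :=
    h.mono fun i hi => hcB _ _ hi.fact hi.norm hi.cond
  obtain ⟨ls₀, core₀, h1, h2, h3, h4, h5⟩ := ILUChain.exists_limit u hδ hc hp (n - 0) rfl
    (T := fun _ => A) tendsto_const_nhds (h.mono fun i hi => hi.fact)
    (h.mono fun i hi => hi.norm)
  obtain ⟨Q₀, R₀, h6, h7, h8⟩ := IsQRCP.exists_limit (π := π) u
    (tendsto_schur hd (ls := ls) (ls₀ := ls₀) h3) (h.mono fun i hi => hi.qr)
  refine ⟨ls₀, core₀, Q₀, R₀, h1, ⟨h2, ?_⟩, h6, h3, h7, h8, h4, h5⟩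
  refine CondLE.of_tendsto (tendsto_pivots hd (ls := ls) h3) (h.mono fun i hi => hi.cond) ?_
  rw [Matrix.det_diagonal, isUnit_iff_ne_zero, Finset.prod_ne_zero_iff]
  intro a _
  have := ge_of_tendsto (tendsto_matrix_iff.1 h3 (Fin.castLE hd a) (Fin.castLE hd a)).abs
    (hp.mono fun i hi => (hi (Fin.castLE hd a) (by simp)).1)
  exact abs_pos.1 (hc.trans_le this)

lemma tendsto_hifOperator {F : Filter ι} {core₀ : Matrix (Fin n) (Fin n) ℝ}
    {ls₀ : List (ILULevel n)} {Q₀ R₀ : Matrix (Fin (n - d)) (Fin (n - d)) ℝ}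
    (hcore : Tendsto core F (𝓝 core₀)) (hQ : Tendsto Q F (𝓝 Q₀)) (hR : Tendsto R F (𝓝 R₀))
    (hL : Tendsto (fun i => leftProd (ls i)) F (𝓝 (leftProd ls₀)))
    (hU : Tendsto (fun i => rightProd (ls i)) F (𝓝 (rightProd ls₀)))
    (hK : (MLILU.mk ls₀ d hd core₀).WellConditioned K) {k : ℕ} (hk : k ≤ n - d)
    (hdet : IsUnit (leadingBlock hk R₀).det) :
    Tendsto (fun i => hifOperator (MLILU.mk (ls i) d hd (core i)) π (Q i) (R i) hk) F
      (𝓝 (hifOperator (MLILU.mk ls₀ d hd core₀) π Q₀ R₀ hk)) := by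
  have hQt : Tendsto (fun i => (Q i)ᵀ) F (𝓝 Q₀ᵀ) :=
    (continuous_id.matrix_transpose.tendsto Q₀).comp hQ
  have hpad : Tendsto (fun i => paddedInv hk (R i)) F (𝓝 (paddedInv hk R₀)) :=
    tendsto_blockDiag hk (tendsto_matrix_inv (tendsto_leadingBlock hR hk) hdet) tendsto_const_nhds
  have hD := tendsto_matrix_inv (tendsto_pivots hd (ls := ls) (ls₀ := ls₀) hcore) hK.2.1
  have hP : Tendsto (fun i => π.permMatrix ℝ * paddedInv hk (R i) * (Q i)ᵀ) F
      (𝓝 (π.permMatrix ℝ * paddedInv hk R₀ * Q₀ᵀ)) := (tendsto_const_nhds.mul hpad).mul hQt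
  have hM := tendsto_blockDiag hd hD hP
  have hU' := tendsto_matrix_inv hU (isUnit_det_rightProd _ hK.1)
  have hL' := tendsto_matrix_inv hL (isUnit_det_leftProd _ hK.1)
  exact (hU'.mul hM).mul hL'

lemma isUnit_det_middle_iff {F : MLILU n} {k : ℕ} (hk : k ≤ n - F.d)
    {R : Matrix (Fin (n - F.d)) (Fin (n - F.d)) ℝ} (hK : F.WellConditioned K) :
    IsUnit (F.middle hk R).det ↔ IsUnit (leadingBlock hk R).det := by
  rw [MLILU.middle, Matrix.det_fromBlocks_zero₁₂, IsUnit.mul_iff]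
  exact and_iff_right hK.2.1

/-- Truncating an upper triangular factor does not increase the condition number. -/
lemma condLE_middle {F : MLILU n} {k m : ℕ} (hk : k ≤ n - F.d) (hm : m ≤ n - F.d) (hkm : k ≤ m)
    {R : Matrix (Fin (n - F.d)) (Fin (n - F.d)) ℝ} (hR : ∀ i j, j < i → R i j = 0)
    (hdet : IsUnit (F.middle hm R).det) :
    CondLE (F.middle hk R) (‖F.middle hm R‖ * ‖(F.middle hm R)⁻¹‖) := by
  set f : Fin F.d ⊕ Fin k → Fin F.d ⊕ Fin m := Sum.map id (Fin.castLE hkm)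
  have hf : Function.Injective f := Function.injective_id.sumMap (Fin.castLE_injective hkm)
  have h1 : F.middle hk R = (F.middle hm R).submatrix f f := by
    ext i j
    rcases i with i | i <;> rcases j with j | j <;> rfl
  rw [h1]
  refine condLE_submatrix hdet hf ?_
  rintro (t | t) j ht
  · exact absurd ⟨Sum.inl t, rfl⟩ ht
  · have htk : k ≤ t.val := by
      by_contra! hlt
      exact ht ⟨Sum.inr ⟨t, hlt⟩, rfl⟩
    rcases j with j | j
    · rfl
    · refine hR _ _ ?_
      rw [Fin.lt_def]
      simpa using j.2.trans_le htk

/-- If the droppings tend to `0`, then the truncation eventually takes place at the exact rank: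
a larger block would be singular in the limit, and a smaller one is excluded because the
threshold resolves the rank. -/
lemma eq_rank_of_limit (hA : A ≠ 0) (u : Ultrafilter ι) {τ : ℝ} (hτ : ResolvesRank A K τ) {k : ℕ}
    (hk : k ≤ n - d) (hcond : ∀ᶠ i in (u : Filter ι),
      CondLE ((MLILU.mk (ls i) d hd (core i)).middle hk (R i)) K)
    (htrunc : ∀ᶠ i in (u : Filter ι), ∀ hk' : k + 1 ≤ n - d,
      ¬ CondLE ((MLILU.mk (ls i) d hd (core i)).middle hk' (R i)) τ)
    {core₀ : Matrix (Fin n) (Fin n) ℝ} {ls₀ : List (ILULevel n)}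
    {Q₀ R₀ : Matrix (Fin (n - d)) (Fin (n - d)) ℝ}
    (hF : (MLILU.mk ls₀ d hd core₀).IsFactorization A 0)
    (hK : (MLILU.mk ls₀ d hd core₀).WellConditioned K)
    (hqr : IsQRCP (MLILU.mk ls₀ d hd core₀).schur π Q₀ R₀)
    (hcore : Tendsto core u (𝓝 core₀)) (hR : Tendsto R u (𝓝 R₀)) :
    k = (MLILU.mk ls₀ d hd core₀).schur.rank := by
  set F₀ := MLILU.mk ls₀ d hd core₀ with hF₀
  have hρ : F₀.schur.rank ≤ n - d := by
    simpa using Matrix.rank_le_card_width F₀.schur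
  have hmid : ∀ {m : ℕ} (hm : m ≤ n - d),
      Tendsto (fun i => (MLILU.mk (ls i) d hd (core i)).middle hm (R i)) u
        (𝓝 (F₀.middle hm R₀)) := fun hm => tendsto_middle hd hcore hR hm
  apply le_antisymm
  · refine hqr.le_rank hk ((isUnit_det_middle_iff (F := F₀) hk hK).1 ?_)
    rcases Nat.eq_zero_or_pos d with hd0 | hd0
    · rcases Nat.eq_zero_or_pos k with hk0 | hk0
      · subst hd0 hk0
        have : IsEmpty (Fin F₀.d ⊕ Fin 0) := inferInstanceAs (IsEmpty (Fin 0 ⊕ Fin 0))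
        rw [Matrix.det_isEmpty]
        exact isUnit_one
      · -- without pivots, `R₀` comes from `A` itself, and its first diagonal entry is nonzero
        have hrank : 0 < F₀.schur.rank := by
          have h1 := (exact_hifOperator hF hK hqr hρ).choose_spec.2.2.2
          have h2 : 0 < A.rank := by
            rw [Nat.pos_iff_ne_zero]
            intro h0
            rw [Matrix.rank, Submodule.finrank_eq_zero, LinearMap.range_eq_bot] at h0
            refine hA (Matrix.ext_of_mulVec_single fun i => ?_)
            rw [Matrix.zero_mulVec]
            exact LinearMap.congr_fun h0 (Pi.single i 1)
          have h3 : F₀.d = 0 := hd0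
          omega
        refine (CondLE.of_tendsto_of_ne_zero (hmid hk) hcond fun h0 => ?_).1
        have h1 := congrFun (congrFun h0 (Sum.inr ⟨0, hk0⟩)) (Sum.inr ⟨0, hk0⟩)
        exact hqr.of_rank.1 (Fin.castLE hk ⟨0, hk0⟩) hrank h1
    · refine (CondLE.of_tendsto_of_ne_zero (hmid hk) hcond fun h0 => ?_).1
      have h1 := congrFun (congrFun h0 (Sum.inl ⟨0, hd0⟩)) (Sum.inl ⟨0, hd0⟩)
      have h2 : F₀.pivots ⟨0, hd0⟩ = 0 := by
        simpa [MLILU.middle] using h1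
      have h3 := hK.2.1
      rw [Matrix.det_diagonal, isUnit_iff_ne_zero, Finset.prod_ne_zero_iff] at h3
      exact h3 ⟨0, hd0⟩ (Finset.mem_univ _) h2
  · by_contra! hlt
    have hk' : k + 1 ≤ n - d := (Nat.succ_le_of_lt hlt).trans hρ
    have h1 : IsUnit (F₀.middle hρ R₀).det :=
      (isUnit_det_middle_iff (F := F₀) hρ hK).2 (hqr.isUnit_det_leadingBlock hρ le_rfl)
    have h2 := condLE_middle (F := F₀) hk' hρ (Nat.succ_le_of_lt hlt) hqr.upper h1
    have h3 := h2.2.trans_lt (hτ F₀ π Q₀ R₀ _ hρ hF hK hqr rfl)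
    have h4 := (tendsto_norm_mul_norm_inv (hmid hk') h2.1).eventually_lt_const h3
    obtain ⟨i, h5, h6, h7⟩ :=
      (h4.and ((eventually_isUnit_det (hmid hk') h2.1).and htrunc)).exists
    exact h7 hk' ⟨h6, h5.le⟩

end HIFLimits

/-! ### The resolved rank and the accuracy of the hybrid operators -/

lemma IsHIF.mono {n : ℕ} {A G : Matrix (Fin n) (Fin n) ℝ} {δ δ' K τ : ℝ} (h : IsHIF A δ K τ G)
    (hδ : δ ≤ δ') : IsHIF A δ' K τ G := by
  obtain ⟨F, π, Q, R, k, hk, h1, h⟩ := h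
  exact ⟨F, π, Q, R, k, hk, ILUChain.mono h1 hδ, h⟩

/-- Every large enough threshold resolves the rank. Otherwise the condition numbers at the exact
rank are unbounded along a sequence of exact factorizations, which contradicts its convergence to
an exact factorization, whose Schur complement has the same rank. -/
lemma exists_resolvesRank {n : ℕ} (A : Matrix (Fin n) (Fin n) ℝ) (K : ℝ) :
    ∃ τ₀ : ℝ, ∀ τ : ℝ, τ₀ ≤ τ → ResolvesRank A K τ := by
  by_contra! hcon
  have hex : ∀ j : ℕ, ∃ d : Fin (n + 1),
      ∃ x : List (ILULevel n) × Matrix (Fin n) (Fin n) ℝ × Equiv.Perm (Fin (n - d)) ×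
        Matrix (Fin (n - d)) (Fin (n - d)) ℝ × Matrix (Fin (n - d)) (Fin (n - d)) ℝ,
      ∀ hd : d.val ≤ n,
      (MLILU.mk x.1 d hd x.2.1).IsNormalizedQR A 0 K x.2.2.1 x.2.2.2.1 x.2.2.2.2 ∧
      ∀ k (hk : k ≤ n - d), k = A.rank - d →
        (j : ℝ) ≤ ‖(MLILU.mk x.1 d hd x.2.1).middle hk x.2.2.2.2‖ *
          ‖((MLILU.mk x.1 d hd x.2.1).middle hk x.2.2.2.2)⁻¹‖ := by
    intro j
    obtain ⟨τ, hτ, hres⟩ := hcon j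
    simp only [ResolvesRank, not_forall, not_lt] at hres
    obtain ⟨⟨ls, d, hd, core⟩, π, Q, R, k, hk, h1, h2, h3, rfl, h5⟩ := hres
    have h6 := (exact_hifOperator h1 h2 h3 hk).choose_spec.2.2.2
    obtain ⟨ls', core', R', c, hc, h7, h8, -⟩ := MLILU.exists_isNormalizedQR h1 h2 h3
    refine ⟨⟨d, Nat.lt_succ_of_le hd⟩, (ls', core', π, Q, R'), fun _ => ⟨h7, ?_⟩⟩
    rintro k' hk' hkd
    have hkk : k' = (MLILU.mk ls d hd core).schur.rank := by
      simp only at h6 hkd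
      omega
    subst hkk
    simp only at hk' ⊢
    rw [h8, norm_smul_mul_norm_inv _ hc]
    exact hτ.trans h5
  -- the number of pivots and the permutation are constant along the ultrafilter
  choose d hx using hex
  set u : Ultrafilter ℕ := hyperfilter ℕ
  obtain ⟨d₀, hd₀⟩ := u.exists_eventually_eq d
  have hd : d₀.val ≤ n := Nat.lt_succ_iff.1 d₀.2
  obtain ⟨x, hx⟩ := (hd₀.mono fun j hj => hj ▸ hx j).choice
  replace hx := hx.mono fun j hj => hj hd
  obtain ⟨π, hπ⟩ := u.exists_eventually_eq fun j => (x j).2.2.1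
  have hnorm : ∀ᶠ j in (u : Filter ℕ), (MLILU.mk (x j).1 d₀ hd (x j).2.1).IsNormalizedQR A 0 K π
      (x j).2.2.2.1 (x j).2.2.2.2 := by
    filter_upwards [hx, hπ] with j h1 h2
    exact h2 ▸ h1.1
  obtain ⟨ls₀, core₀, Q₀, R₀, h1, h2, h3, h4, -, h6, -, -⟩ :=
    MLILU.IsNormalizedQR.exists_limit hd u tendsto_const_nhds hnorm
  set F₀ := MLILU.mk ls₀ d₀ hd core₀ with hF₀
  have hρ : F₀.schur.rank ≤ n - d₀ := by
    simpa using Matrix.rank_le_card_width F₀.schur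
  have h7 : F₀.schur.rank = A.rank - d₀ := by
    have := (exact_hifOperator h1 h2 h3 hρ).choose_spec.2.2.2
    simp only [hF₀] at this ⊢
    omega
  have h8 : IsUnit (F₀.middle hρ R₀).det :=
    (isUnit_det_middle_iff (F := F₀) hρ h2).2 (h3.isUnit_det_leadingBlock hρ le_rfl)
  have h9 := tendsto_norm_mul_norm_inv
    (tendsto_middle hd (ls := fun j => (x j).1) (ls₀ := ls₀) h4 h6 hρ) h8
  have h10 : Tendsto (fun j : ℕ => (j : ℝ)) u atTop :=
    tendsto_natCast_atTop_atTop.mono_left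
      (hyperfilter_le_cofinite.trans Nat.cofinite_eq_atTop.le)
  have h11 := tendsto_atTop_mono' _ (hx.mono fun j hj => hj.2 _ hρ h7) h10
  exact not_tendsto_nhds_of_tendsto_atTop h11 _ h9

/-- The hybrid operators are accurate once the droppings are small: otherwise a sequence of
inaccurate ones with droppings tending to `0` would converge to a generalized inverse of `A`. -/
lemma exists_accurateAGI {n : ℕ} {A : Matrix (Fin n) (Fin n) ℝ} (hA : A ≠ 0) {K τ : ℝ}
    (hτ : ResolvesRank A K τ) {ε : ℝ} (hε : 0 < ε) :
    ∃ δ₀ : ℝ, 0 < δ₀ ∧ ∀ G : Matrix (Fin n) (Fin n) ℝ, IsHIF A δ₀ K τ G →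
      ∃ ε' : ℝ, ε' ≤ ε ∧ IsAccurateAGI A G ε' := by
  by_contra! hcon
  have hex : ∀ j : ℕ, ∃ dk : Fin (n + 1) × Fin (n + 1),
      (dk.1.val ≤ n ∧ dk.2.val ≤ n - dk.1) ∧
      ∃ x : List (ILULevel n) × Matrix (Fin n) (Fin n) ℝ × Equiv.Perm (Fin (n - dk.1)) ×
        Matrix (Fin (n - dk.1)) (Fin (n - dk.1)) ℝ × Matrix (Fin (n - dk.1)) (Fin (n - dk.1)) ℝ,
      ∀ (hd : dk.1.val ≤ n) (hk : dk.2.val ≤ n - dk.1),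
      (MLILU.mk x.1 dk.1 hd x.2.1).IsNormalizedQR A (1 / ((j : ℝ) + 1)) K x.2.2.1 x.2.2.2.1
        x.2.2.2.2 ∧
      CondLE ((MLILU.mk x.1 dk.1 hd x.2.1).middle hk x.2.2.2.2) K ∧
      (∀ hk' : dk.2.val + 1 ≤ n - dk.1,
        ¬ CondLE ((MLILU.mk x.1 dk.1 hd x.2.1).middle hk' x.2.2.2.2) τ) ∧
      ∀ ε' ≤ ε, ¬ IsAccurateAGI A
        (hifOperator (MLILU.mk x.1 dk.1 hd x.2.1) x.2.2.1 x.2.2.2.1 x.2.2.2.2 hk) ε' := by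
    intro j
    obtain ⟨G, ⟨⟨ls, d, hd, core⟩, π, Q, R, k, hk, h1, h2, h3, h4, h5, rfl⟩, hG⟩ :=
      hcon (1 / ((j : ℝ) + 1)) (by positivity)
    obtain ⟨ls', core', R', c, hc, h7, h8, h9⟩ := MLILU.exists_isNormalizedQR h1 h2 h3
    refine ⟨(⟨d, Nat.lt_succ_of_le hd⟩, ⟨k, Nat.lt_succ_of_le (hk.trans (Nat.sub_le _ _))⟩),
      ⟨hd, hk⟩, (ls', core', π, Q, R'), fun _ _ => ⟨h7, ?_, ?_, ?_⟩⟩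
    · simp only
      rw [h8, condLE_smul_iff _ hc]
      exact h4
    · intro hk'
      simp only
      rw [h8, condLE_smul_iff _ hc]
      exact h5 hk'
    · simp only
      rw [h9]
      exact hG
  -- the number of pivots, the truncation index and the permutation are constant along the
  -- ultrafilter
  choose dk hx using hex
  set u : Ultrafilter ℕ := hyperfilter ℕ
  obtain ⟨⟨d, k⟩, hdk⟩ := u.exists_eventually_eq dk
  have hx' := hdk.mono fun j hj => hj ▸ hx j
  obtain ⟨-, ⟨hd, hk⟩, -⟩ := hx'.exists
  simp only at hd hk
  obtain ⟨x, hx⟩ := (hx'.mono fun j hj => hj.2).choice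
  replace hx := hx.mono fun j hj => hj hd hk
  obtain ⟨π, hπ⟩ := u.exists_eventually_eq fun j => (x j).2.2.1
  have hδ : Tendsto (fun j : ℕ => 1 / ((j : ℝ) + 1)) u (𝓝 0) :=
    tendsto_one_div_add_atTop_nhds_zero_nat.mono_left
      (hyperfilter_le_cofinite.trans Nat.cofinite_eq_atTop.le)
  have hnorm : ∀ᶠ j in (u : Filter ℕ), (MLILU.mk (x j).1 d hd (x j).2.1).IsNormalizedQR A
      (1 / ((j : ℝ) + 1)) K π (x j).2.2.2.1 (x j).2.2.2.2 := by
    filter_upwards [hx, hπ] with j h1 h2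
    exact h2 ▸ h1.1
  obtain ⟨ls₀, core₀, Q₀, R₀, h1, h2, h3, h4, h5, h6, h7, h8⟩ :=
    MLILU.IsNormalizedQR.exists_limit hd u hδ hnorm
  have hkr := eq_rank_of_limit hd hA u hτ hk (hx.mono fun j hj => hj.2.1)
    (hx.mono fun j hj => hj.2.2.1) h1 h2 h3 h4 h6
  obtain ⟨d, hdlt⟩ := d
  obtain ⟨k, hklt⟩ := k
  simp only at hd hk hkr h1 h2 h3
  subst hkr
  have hG := tendsto_hifOperator hd (π := π) (ls := fun j => (x j).1) h4 h5 h6 h7 h8 h2 hk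
    (h3.isUnit_det_leadingBlock hk le_rfl)
  obtain ⟨X, hX, hAGA, hAG, hrank⟩ := exact_hifOperator h1 h2 h3 hk
  set G₀ := hifOperator (MLILU.mk ls₀ d hd core₀) π Q₀ R₀ hk
  rw [← hrank] at hAG
  have hlim : X⁻¹ * A * G₀ * X = idBlock n A.rank := by
    rw [Matrix.mul_assoc X⁻¹ A G₀, hAG, Matrix.mul_assoc, Matrix.mul_assoc (X * idBlock n A.rank),
      Matrix.nonsing_inv_mul _ hX, Matrix.mul_one, Matrix.nonsing_inv_mul_cancel_left _ _ hX]
  have hnormlim := ((((tendsto_const_nhds (x := X⁻¹ * A)).mul hG).mul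
    (tendsto_const_nhds (x := X))).sub (tendsto_const_nhds (x := idBlock n A.rank))).norm
  rw [hlim, sub_self, norm_zero] at hnormlim
  obtain ⟨j, hj1, hj2, hj3⟩ := ((hnormlim.eventually_lt_const (lt_min hε one_pos)).and
    (hx.and hπ)).exists
  refine hj2.2.2.2 _ ?_ ⟨X, hX, ⟨G₀, hAGA, hAG⟩, rfl, ?_⟩
  · rw [hj3]
    exact hj1.le.trans (min_le_left _ _)
  · rw [hj3]
    exact hj1.trans_le (min_le_right _ _)

theorem mainTheorem3 (n : ℕ) (A : Matrix (Fin n) (Fin n) ℝ) (hA : A ≠ 0) (K : ℝ) :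
    (∃ τ₀ : ℝ, ∀ τ : ℝ, τ₀ ≤ τ → ResolvesRank A K τ) ∧
    ∀ τ : ℝ, ResolvesRank A K τ → ∀ ε : ℝ, 0 < ε →
      ∃ δ₀ : ℝ, 0 < δ₀ ∧ ∀ δ : ℝ, δ ≤ δ₀ → ∀ G : Matrix (Fin n) (Fin n) ℝ, IsHIF A δ K τ G →
        (∃ ε' : ℝ, ε' ≤ ε ∧ IsAccurateAGI A G ε') ∧
        ∀ b : Fin n → ℝ, b ∈ Set.range A.mulVec → ∀ x₀ : Fin n → ℝ, GMRESFindsLS A G b x₀ := by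
  refine ⟨exists_resolvesRank A K, fun τ hτ ε hε => ?_⟩
  obtain ⟨δ₀, hδ₀, h⟩ := exists_accurateAGI hA hτ hε
  refine ⟨δ₀, hδ₀, fun δ hδ G hG => ?_⟩
  obtain ⟨ε', hε', hAGI⟩ := h G (hG.mono hδ)
  exact ⟨⟨ε', hε', hAGI⟩, fun b hb x₀ =>
    gmresFindsLS_of_injOn (fun v hv => hAGI.eq_zero_of_mulVec_eq_zero hv) hb x₀⟩
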